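/- Let $n\in\mathbb N$, let $\lambda=(\lambda_1,\dots,\lambda_n)\in(-1/2,\infty)^n$, and let $d\mu_\lambda(x)=\prod_{j=1}^n x_j^{2\lambda_j}\,dx_j$ on $(0,\infty)^n$. For $l>-1/2$ and $s,x,y\in(0,\infty)$ let $$W_s^{l}(x,y)=\frac{(xy)^{-l+1/2}}{2s}\,I_{l-1/2}\!\left(\frac{xy}{2s}\right)e^{-(x^2+y^2)/4s},$$ where $I_\nu(z)=\sum_{k=0}^\infty \frac{(z/2)^{2k+\nu}}{k!\,\Gamma(k+\nu+1)}$ is the modified Bessel function of the first kind. Let $r=(r_1,\dots,r_n)$, where each $r_j:[0,\infty)\to[0,\infty)$ is continuous and nondecreasing with $r_j(0)=0$, $r_j(t)>0$ for $t>0$, and $\lim_{t\to\infty}r_j(t)=\infty$. For real- or complex-valued $f\in L^p((0,\infty)^n,d\mu_\lambda)$, $1\le p\le\infty$, set $$\mathbb W^\lambda_{r(t)}f(x)=\int_{(0,\infty)^n}\prod_{j=1}^n W^{\lambda_j}_{r_j(t)}(x_j,y_j)\,f(y)\,d\mu_\lambda(y),\qquad \mathbb W^\lambda_{r,*}f(x)=\sup_{t>0}\bigl|\mathbb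 W^\lambda_{r(t)}f(x)\bigr|,\qquad x\in(0,\infty)^n.$$ These integrals converge absolutely for all $t>0$ and $x\in(0,\infty)^n$, and $\mathbb W^\lambda_{r,*}f$ is $\mu_\lambda$-measurable. Moreover: 1. For every $1<p\le\infty$ there is a constant $C<\infty$ such that $\|\mathbb W^\lambda_{r,*}f\|_{L^p((0,\infty)^n,d\mu_\lambda)}\le C\|f\|_{L^p((0,\infty)^n,d\mu_\lambda)}$ for all $f\in L^p((0,\infty)^n,d\mu_\lambda)$. 2. There is a constant $C<\infty$ such that $\gamma\,\mu_\lambda\bigl(\{x\in(0,\infty)^n:\mathbb W^\lambda_{r,*}f(x)>\gamma\}\bigr)\le C\|f\|_{L^1((0,\infty)^n,d\mu_\lambda)}$ for all $f\in L^1((0,\infty)^n,d\mu_\lambda)$ and all $\gamma>0$. -/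

import Mathlib

open MeasureTheory Set Filter Topology
open scoped ENNReal NNReal Nat

/-- The modified Bessel function of the first kind and real order `ν`, on `(0, ∞)`:
`I_ν(z) = ∑_{k ≥ 0} (z / 2) ^ (2 k + ν) / (k! Γ(k + ν + 1))`. -/
noncomputable def modifiedBesselI (ν z : ℝ) : ℝ :=
  ∑' k : ℕ, (z / 2) ^ (2 * (k : ℝ) + ν) / ((k ! : ℝ) * Real.Gamma ((k : ℝ) + ν + 1))

/-- The series defining `I_ν(z)` converges for `ν > -1`, `z > 0`, so that the sum above is genuine. -/
theorem summable_modifiedBesselI {ν z : ℝ} (hν : -1 < ν) (hz : 0 < z) :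
    Summable fun k : ℕ =>
      (z / 2) ^ (2 * (k : ℝ) + ν) / ((k ! : ℝ) * Real.Gamma ((k : ℝ) + ν + 1)) := by
  have hz2 : 0 < z / 2 := by positivity
  have hG : ∀ k : ℕ, 0 < Real.Gamma ((k : ℝ) + ν + 1) := fun k =>
    Real.Gamma_pos_of_pos (by have : (0 : ℝ) ≤ k := k.cast_nonneg; linarith)
  have hpos : ∀ k : ℕ,
      0 < (z / 2) ^ (2 * (k : ℝ) + ν) / ((k ! : ℝ) * Real.Gamma ((k : ℝ) + ν + 1)) := fun k =>
    div_pos (Real.rpow_pos_of_pos hz2 _) (mul_pos (by exact_mod_cast k.factorial_pos) (hG k))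
  refine summable_of_ratio_test_tendsto_lt_one (l := 0) one_pos
    (Eventually.of_forall fun k => (hpos k).ne') ?_
  have key : ∀ k : ℕ,
      ‖(z / 2) ^ (2 * ((k + 1 : ℕ) : ℝ) + ν) /
          (((k + 1)! : ℝ) * Real.Gamma (((k + 1 : ℕ) : ℝ) + ν + 1))‖ /
        ‖(z / 2) ^ (2 * (k : ℝ) + ν) / ((k ! : ℝ) * Real.Gamma ((k : ℝ) + ν + 1))‖
      = (z / 2) ^ 2 * ((1 / ((k : ℝ) + 1)) * ((k : ℝ) + (ν + 1))⁻¹) := by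
    intro k
    have hk : (0 : ℝ) ≤ k := k.cast_nonneg
    rw [Real.norm_of_nonneg (hpos _).le, Real.norm_of_nonneg (hpos _).le]
    have e1 : 2 * ((k + 1 : ℕ) : ℝ) + ν = (2 * (k : ℝ) + ν) + (2 : ℕ) := by push_cast; ring
    have e2 : ((k + 1 : ℕ) : ℝ) + ν + 1 = ((k : ℝ) + ν + 1) + 1 := by push_cast; ring
    have h0 : (k : ℝ) + ν + 1 ≠ 0 := by intro h; linarith
    rw [e1, Real.rpow_add_natCast hz2.ne', e2, Real.Gamma_add_one h0, Nat.factorial_succ,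
      ← add_assoc]
    have h1 := (Real.rpow_pos_of_pos hz2 (2 * (k : ℝ) + ν)).ne'
    have h2 := (hG k).ne'
    have h3 : (k ! : ℝ) ≠ 0 := by exact_mod_cast k.factorial_ne_zero
    have h4 : (k : ℝ) + 1 ≠ 0 := by positivity
    push_cast
    field_simp
  simp_rw [key]
  have t1 : Tendsto (fun k : ℕ => 1 / ((k : ℝ) + 1)) atTop (𝓝 0) :=
    tendsto_one_div_add_atTop_nhds_zero_nat
  have t2 : Tendsto (fun k : ℕ => ((k : ℝ) + (ν + 1))⁻¹) atTop (𝓝 0) :=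
    tendsto_inv_atTop_zero.comp (tendsto_atTop_add_const_right _ _ tendsto_natCast_atTop_atTop)
  simpa using (t1.mul t2).const_mul ((z / 2) ^ 2)

/-- The one-dimensional Bessel (Hankel) heat kernel
`W_t^l(x, y) = (x y)^(1/2 - l) / (2 t) * I_{l - 1/2}(x y / (2 t)) * exp (-(x² + y²) / (4 t))`,
for `x, y, t > 0` and `l > -1/2`. -/
noncomputable def besselHeatKernel (l t x y : ℝ) : ℝ :=
  (x * y) ^ (-l + 1 / 2) / (2 * t) * modifiedBesselI (l - 1 / 2) (x * y / (2 * t)) *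
    Real.exp (-(x ^ 2 + y ^ 2) / (4 * t))

/-- The measure `dμ_lam(x) = ∏ j, x_j ^ (2 lam_j) dx_j` on `(0, ∞)^n`, viewed as a measure on
`ℝ^n` for which the complement of `(0, ∞)^n` is a null set. -/
noncomputable def besselMeasure {n : ℕ} (lam : Fin n → ℝ) : Measure (Fin n → ℝ) :=
  Measure.pi fun j =>
    (volume.restrict (Ioi (0 : ℝ))).withDensity fun x => ENNReal.ofReal (x ^ (2 * lam j))

/-- The kernel `∏ j, W_{s_j}^{lam_j}(x_j, y_j)` with one time parameter `s_j` for each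
coordinate. -/
noncomputable def besselHeatKernelPi {n : ℕ} (lam s x y : Fin n → ℝ) : ℝ :=
  ∏ j, besselHeatKernel (lam j) (s j) (x j) (y j)

/-- The operator `f ↦ ∫ (∏ j, W_{s_j}^{lam_j}(x_j, y_j)) f(y) dμ_lam(y)`. -/
noncomputable def besselHeat {𝕜 : Type*} [RCLike 𝕜] {n : ℕ} (lam s : Fin n → ℝ)
    (f : (Fin n → ℝ) → 𝕜) (x : Fin n → ℝ) : 𝕜 :=
  ∫ y, besselHeatKernelPi lam s x y • f y ∂(besselMeasure lam)

/-- The generalized maximal operator `f ↦ sup_{t > 0} |W^lam_{r(t)} f|`, where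
`r(t) = (r_1(t), …, r_n(t))`, with values in `[0, ∞]`. -/
noncomputable def besselHeatMaximal {𝕜 : Type*} [RCLike 𝕜] {n : ℕ} (lam : Fin n → ℝ)
    (r : Fin n → ℝ → ℝ) (f : (Fin n → ℝ) → 𝕜) (x : Fin n → ℝ) : ℝ≥0∞ :=
  ⨆ t : ℝ, ⨆ _ : 0 < t, ‖besselHeat lam (fun j => r j t) f x‖ₑ

/-!
The maximal operator is dominated by averages over rectangles, and the rectangles form
one-parameter increasing families, for which a Vitali covering argument works.

In one dimension the modified Bessel function satisfies
`I_ν(z) ≤ C z ^ ν (1 + z) ^ (-ν - 1 / 2) e ^ z` (`exists_modifiedBesselI_le`). Hence, for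
`|x - y| < κ √s` with `κ ≥ 1`, the heat kernel is at most a power of `κ` times
`exp (-(x - y) ^ 2 / (4 s))`, divided by the measure of the ball with centre `x` and radius `κ √s`
(`exists_besselHeatKernel_mul_ball_le`). In the product of the one-dimensional kernels take the
least `m` such that `y` lies in the rectangle with centre `x` and half sides `2 ^ m √(s j)`. One
of the exponentials is then at most a constant times `exp (-4 ^ m / 16)`, which absorbs all powers
of `2 ^ m`, and the kernel is at most `C 4 ^ (-m)` divided by the measure of this rectangle
(`exists_besselHeatKernelPi_le`). Consequently the maximal operator is bounded by
`C ∑ m, 4 ^ (-m) M_m`, where `M_m` is the uncentred maximal function over the rectangles with half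
sides `2 ^ m √(r j t)`, `t > 0` (`exists_besselHeatMaximal_le`).

For fixed `m` all sides of these rectangles increase with `t`. A rectangle meeting one with a
larger `t` is thus contained in the threefold enlargement of the latter, and since the measure is
doubling, `M_m` is of weak type `(1, 1)` with a constant independent of `m`
(`mul_measure_lt_setMaximal_le`, `exists_mul_measure_lt_setMaximal_curveRect_le`). The geometric
weights allow the sum over `m` (`mul_measure_lt_weightedMaximal_le`). The sum is also sublinear
and bounded on `L^∞`, and interpolation gives the strong type `(p, p)`
(`lintegral_weightedMaximal_rpow_le`).

Absolute convergence of the integrals follows from the same majorant by Hölder's inequality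
(`lintegral_besselMajorant_mul_lt_top`). In a form uniform for times in a compact set it gives
continuity in time (`continuousAt_besselHeat`), so that the supremum over `t > 0` is a countable
one almost everywhere, and hence measurable.
-/

/-! ### Upper bound and continuity of the modified Bessel function -/

theorem Real.Gamma_add_natCast_eq_prod {s : ℝ} (hs : 0 < s) (k : ℕ) :
    Real.Gamma (k + s) = Real.Gamma s * ∏ j ∈ Finset.range k, (s + j) := by
  induction k with
  | zero => simp
  | succ k ih =>
    have h0 : (k : ℝ) + s ≠ 0 := by positivity
    rw [Finset.prod_range_succ, ← mul_assoc, ← ih]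
    push_cast
    rw [show (k : ℝ) + 1 + s = (k + s) + 1 by ring, Real.Gamma_add_one h0]
    ring

/-- The order of growth of `Γ (k + s)`, read off from the convergence of Euler's product
`GammaSeq`. -/
theorem Real.exists_inv_Gamma_natCast_add_le {s : ℝ} (hs : 0 < s) :
    ∃ C : ℝ, 0 < C ∧ ∀ k : ℕ,
      (Real.Gamma (k + s))⁻¹ ≤ C * ((k : ℝ) + 1) ^ (1 - s) / (k ! : ℝ) := by
  obtain ⟨C₀, hC₀⟩ := (Real.GammaSeq_tendsto_Gamma s).bddAbove_range
  have hC₀' : ∀ k, Real.GammaSeq s k ≤ C₀ := fun k => hC₀ ⟨k, rfl⟩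
  have hΓ := Real.Gamma_pos_of_pos hs
  have hC₀pos : 0 < C₀ := by
    refine lt_of_lt_of_le ?_ (hC₀' 1)
    simp only [Real.GammaSeq]
    have : 0 < ∏ j ∈ Finset.range (1 + 1), (s + (j : ℝ)) :=
      Finset.prod_pos fun j _ => by positivity
    positivity
  refine ⟨(Real.Gamma s)⁻¹ + (Real.Gamma s)⁻¹ * C₀ * (1 + s) * 2 ^ s, by positivity, ?_⟩
  intro k
  rcases Nat.eq_zero_or_pos k with rfl | hk
  · simp only [Nat.cast_zero, zero_add, Real.one_rpow, Nat.factorial_zero, Nat.cast_one, mul_one,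
      div_one]
    have : 0 ≤ (Real.Gamma s)⁻¹ * C₀ * (1 + s) * 2 ^ s := by positivity
    linarith
  have hk' : (0 : ℝ) < k := by exact_mod_cast hk
  have hk1 : (1 : ℝ) ≤ k := by exact_mod_cast hk
  have hP : 0 < ∏ j ∈ Finset.range k, (s + (j : ℝ)) :=
    Finset.prod_pos fun j _ => by positivity
  have hseq := hC₀' k
  rw [Real.GammaSeq, Finset.prod_range_succ, div_le_iff₀ (by positivity)] at hseq
  have hkf : (0 : ℝ) < (k ! : ℝ) := by positivity
  have hks : 0 < (k : ℝ) ^ s := by positivity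
  have e1 : ((k : ℝ) + 1) ^ s ≤ 2 ^ s * (k : ℝ) ^ s := by
    rw [← Real.mul_rpow (by norm_num) hk'.le]
    exact Real.rpow_le_rpow (by positivity) (by linarith) hs.le
  have hk1s : 0 < ((k : ℝ) + 1) ^ s := by positivity
  rw [Real.Gamma_add_natCast_eq_prod hs k, Real.rpow_sub (by positivity), Real.rpow_one,
    mul_inv]
  set P := ∏ j ∈ Finset.range k, (s + (j : ℝ))
  have e2 : P⁻¹ ≤ C₀ * (1 + s) * 2 ^ s * (((k : ℝ) + 1) / ((k : ℝ) + 1) ^ s) / (k ! : ℝ) := by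
    rw [inv_le_iff_one_le_mul₀ hP]
    have : ((k : ℝ) + 1) ^ s * (k ! : ℝ) ≤ (C₀ * (1 + s) * 2 ^ s * ((k : ℝ) + 1)) * P := by
      calc ((k : ℝ) + 1) ^ s * (k ! : ℝ) ≤ 2 ^ s * (k : ℝ) ^ s * (k ! : ℝ) := by gcongr
        _ = 2 ^ s * ((k : ℝ) ^ s * (k ! : ℝ)) := by ring
        _ ≤ 2 ^ s * (C₀ * (P * (s + k))) := by gcongr
        _ ≤ 2 ^ s * (C₀ * (P * ((1 + s) * (k + 1)))) := by gcongr; nlinarith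
        _ = _ := by ring
    rw [show C₀ * (1 + s) * 2 ^ s * (((k : ℝ) + 1) / ((k : ℝ) + 1) ^ s) / (k ! : ℝ) * P =
      (C₀ * (1 + s) * 2 ^ s * ((k : ℝ) + 1)) * P / (((k : ℝ) + 1) ^ s * (k ! : ℝ)) by
        field_simp]
    rwa [one_le_div (by positivity)]
  calc (Real.Gamma s)⁻¹ * P⁻¹
      ≤ (Real.Gamma s)⁻¹ *
        (C₀ * (1 + s) * 2 ^ s * (((k : ℝ) + 1) / ((k : ℝ) + 1) ^ s) / (k ! : ℝ)) := by gcongr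
    _ = ((Real.Gamma s)⁻¹ * C₀ * (1 + s) * 2 ^ s) *
        (((k : ℝ) + 1) / ((k : ℝ) + 1) ^ s) / (k ! : ℝ) := by ring
    _ ≤ _ := by
      gcongr
      linarith [inv_pos.2 hΓ]

theorem Nat.centralBinom_sq_mul_le (k : ℕ) : k.centralBinom ^ 2 * (2 * k + 1) ≤ 16 ^ k := by
  induction k with
  | zero => simp
  | succ k ih =>
    have h := Nat.succ_mul_centralBinom_succ k
    have h2 : (k + 1) ^ 2 * ((k + 1).centralBinom ^ 2 * (2 * (k + 1) + 1)) ≤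
        (k + 1) ^ 2 * 16 ^ (k + 1) := by
      calc (k + 1) ^ 2 * ((k + 1).centralBinom ^ 2 * (2 * (k + 1) + 1))
          = ((k + 1) * (k + 1).centralBinom) ^ 2 * (2 * k + 3) := by ring
        _ = (k.centralBinom ^ 2 * (2 * k + 1)) * (4 * (2 * k + 1) * (2 * k + 3)) := by
          rw [h]; ring
        _ ≤ 16 ^ k * (16 * (k + 1) ^ 2) := by
          refine Nat.mul_le_mul ih ?_
          nlinarith
        _ = _ := by ring
    exact Nat.le_of_mul_le_mul_left h2 (by positivity)

/-- The central binomial coefficient is at most `4 ^ k / √(k + 1)`, in the form in which it turns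
the Bessel series into the even part of an exponential series. -/
theorem inv_factorial_sq_le (k : ℕ) :
    ((k ! : ℝ) ^ 2 * 4 ^ k)⁻¹ ≤ ((k : ℝ) + 1) ^ (-(1 / 2) : ℝ) / ((2 * k)! : ℝ) := by
  have h1 : (k.centralBinom : ℝ) * ((k : ℝ) + 1) ^ (1 / 2 : ℝ) ≤ 4 ^ k := by
    have h := Nat.centralBinom_sq_mul_le k
    have h' : (k.centralBinom : ℝ) ^ 2 * (2 * k + 1) ≤ 16 ^ k := by exact_mod_cast h
    rw [← Real.sqrt_eq_rpow]
    refine abs_le_of_sq_le_sq' ?_ (by positivity) |>.2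
    rw [mul_pow, Real.sq_sqrt (by positivity), ← pow_mul, mul_comm k 2, pow_mul]
    norm_num
    refine le_trans ?_ h'
    gcongr
    have : (0 : ℝ) ≤ k := k.cast_nonneg
    linarith
  have h2 : ((2 * k)! : ℝ) = k.centralBinom * (k ! : ℝ) ^ 2 := by
    have := Nat.choose_mul_factorial_mul_factorial (show k ≤ 2 * k by omega)
    rw [show 2 * k - k = k by omega] at this
    rw [Nat.centralBinom_eq_two_mul_choose, ← this]
    push_cast; ring
  have hc : (0 : ℝ) < k.centralBinom := by exact_mod_cast k.centralBinom_pos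
  have hk : (0 : ℝ) < (k ! : ℝ) := by positivity
  have hr : (0 : ℝ) < ((k : ℝ) + 1) ^ (1 / 2 : ℝ) := by positivity
  rw [h2, Real.rpow_neg (by positivity), inv_le_iff_one_le_mul₀ (by positivity)]
  rw [show (((k : ℝ) + 1) ^ (1 / 2 : ℝ))⁻¹ / (k.centralBinom * (k ! : ℝ) ^ 2) *
    ((k ! : ℝ) ^ 2 * 4 ^ k) = 4 ^ k / (k.centralBinom * ((k : ℝ) + 1) ^ (1 / 2 : ℝ)) by field_simp]
  rwa [one_le_div (by positivity)]

theorem rpow_neg_le_add_pow {u a : ℝ} {q : ℕ} (hu : 0 < u) (ha : -1 ≤ a) (haq : a ≤ q) :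
    u ^ (-a) ≤ u + (u ^ q)⁻¹ := by
  rcases le_total 1 u with h | h
  · have h1 : u ^ (-a) ≤ u ^ (1 : ℝ) := Real.rpow_le_rpow_of_exponent_le h (by linarith)
    rw [Real.rpow_one] at h1
    have : 0 < (u ^ q)⁻¹ := by positivity
    linarith
  · have h1 : u ^ (-a) ≤ u ^ (-(q : ℝ)) :=
      Real.rpow_le_rpow_of_exponent_ge hu h (by linarith)
    rw [Real.rpow_neg hu.le (q : ℝ), Real.rpow_natCast] at h1
    linarith

theorem factorial_add_le (m q : ℕ) : (m + q)! ≤ q ! * ((m + 1) ^ q * m !) := by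
  induction q with
  | zero => simp
  | succ q ih =>
    rw [← add_assoc, Nat.factorial_succ, Nat.factorial_succ]
    calc (m + q + 1) * (m + q)! ≤ ((q + 1) * (m + 1)) * (q ! * ((m + 1) ^ q * m !)) := by
          refine Nat.mul_le_mul ?_ ih
          nlinarith
      _ = _ := by ring

theorem sum_pow_div_factorial_add_le {z : ℝ} (hz : 0 ≤ z) (q N : ℕ) :
    (1 + z) ^ q * ∑ m ∈ Finset.range N, z ^ m / ((m + q)! : ℝ) ≤ 2 ^ q * Real.exp z := by
  rcases le_total 1 z with h | h
  · calc (1 + z) ^ q * ∑ m ∈ Finset.range N, z ^ m / ((m + q)! : ℝ)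
        ≤ (2 * z) ^ q * ∑ m ∈ Finset.range N, z ^ m / ((m + q)! : ℝ) := by
          gcongr
          linarith
      _ = 2 ^ q * ∑ m ∈ Finset.range N, z ^ (m + q) / ((m + q)! : ℝ) := by
          rw [mul_pow, mul_assoc, Finset.mul_sum]
          congr 1
          refine Finset.sum_congr rfl fun m _ => ?_
          rw [pow_add]; ring
      _ ≤ 2 ^ q * ∑ m ∈ Finset.range (q + N), z ^ m / (m ! : ℝ) := by
          gcongr
          rw [Finset.sum_range_add]
          simp_rw [add_comm q]
          have : 0 ≤ ∑ x ∈ Finset.range q, z ^ x / (x ! : ℝ) :=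
            Finset.sum_nonneg fun _ _ => by positivity
          linarith
      _ ≤ _ := by gcongr; exact Real.sum_le_exp_of_nonneg hz _
  · calc (1 + z) ^ q * ∑ m ∈ Finset.range N, z ^ m / ((m + q)! : ℝ)
        ≤ 2 ^ q * ∑ m ∈ Finset.range N, z ^ m / (m ! : ℝ) := by
          gcongr
          · linarith
          · omega
      _ ≤ _ := by gcongr; exact Real.sum_le_exp_of_nonneg hz _

theorem sum_succ_mul_pow_div_factorial_le {z : ℝ} (hz : 0 ≤ z) (N : ℕ) :
    ∑ m ∈ Finset.range N, ((m : ℝ) + 1) * z ^ m / (m ! : ℝ) ≤ (1 + z) * Real.exp z := by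
  have h1 : ∑ m ∈ Finset.range N, (m : ℝ) * z ^ m / (m ! : ℝ) ≤ z * Real.exp z := by
    cases N with
    | zero => simp; positivity
    | succ N =>
      rw [Finset.sum_range_succ']
      simp only [Nat.cast_zero, zero_mul, zero_div, add_zero]
      calc ∑ k ∈ Finset.range N, ((k + 1 : ℕ) : ℝ) * z ^ (k + 1) / ((k + 1)! : ℝ)
          = z * ∑ k ∈ Finset.range N, z ^ k / (k ! : ℝ) := by
            rw [Finset.mul_sum]
            refine Finset.sum_congr rfl fun k _ => ?_
            rw [Nat.factorial_succ]
            have : (k ! : ℝ) ≠ 0 := by positivity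
            have : (k : ℝ) + 1 ≠ 0 := by positivity
            push_cast
            rw [pow_succ]
            field_simp
        _ ≤ _ := by gcongr; exact Real.sum_le_exp_of_nonneg hz _
  have h2 := Real.sum_le_exp_of_nonneg hz N
  calc ∑ m ∈ Finset.range N, ((m : ℝ) + 1) * z ^ m / (m ! : ℝ)
      = ∑ m ∈ Finset.range N, (m : ℝ) * z ^ m / (m ! : ℝ)
        + ∑ m ∈ Finset.range N, z ^ m / (m ! : ℝ) := by
        rw [← Finset.sum_add_distrib]
        refine Finset.sum_congr rfl fun k _ => ?_
        ring
    _ ≤ _ := by linarith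

theorem sum_range_two_mul_le {f : ℕ → ℝ} (hf : ∀ m, 0 ≤ f m) (N : ℕ) :
    ∑ k ∈ Finset.range N, f (2 * k) ≤ ∑ m ∈ Finset.range (2 * N), f m := by
  induction N with
  | zero => simp
  | succ N ih =>
    rw [Finset.sum_range_succ, mul_add, Finset.sum_range_succ, Finset.sum_range_succ]
    linarith [hf (2 * N + 1)]

/-- If `N` is Poisson distributed with mean `z`, then `E[(N + 1) ^ (-a)]` is of order
`(1 + z) ^ (-a)`; this is that bound, multiplied by `e ^ z`, for partial sums over the even values
of `N`. The power `u ^ (-a)` of `u = (k + 1) / (1 + z)` is interpolated between the integer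
exponents `1` and `-q`, for which the sums are explicit. -/
theorem exists_sum_rpow_mul_pow_div_factorial_le {a : ℝ} (ha : -1 ≤ a) :
    ∃ C : ℝ, 0 < C ∧ ∀ z : ℝ, 0 ≤ z → ∀ N : ℕ,
      ∑ k ∈ Finset.range N, ((k : ℝ) + 1) ^ (-a) * (z ^ (2 * k) / ((2 * k)! : ℝ)) ≤
        C * (1 + z) ^ (-a) * Real.exp z := by
  obtain ⟨q, hq⟩ := exists_nat_ge a
  refine ⟨1 + 2 ^ q * q ! * 2 ^ q, by positivity, fun z hz N => ?_⟩
  have h1z : 0 < 1 + z := by linarith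
  set F : ℕ → ℝ := fun m => ((m : ℝ) + 1) * z ^ m / (m ! : ℝ) * (1 + z)⁻¹ +
    2 ^ q * q ! * (1 + z) ^ q * (z ^ m / ((m + q)! : ℝ)) with hF
  have key : ∀ k : ℕ, ((k : ℝ) + 1) ^ (-a) * (z ^ (2 * k) / ((2 * k)! : ℝ)) ≤
      (1 + z) ^ (-a) * F (2 * k) := by
    intro k
    have hk : (0 : ℝ) ≤ k := k.cast_nonneg
    have hu : 0 < ((k : ℝ) + 1) / (1 + z) := by positivity
    have h1 := rpow_neg_le_add_pow hu ha hq
    have h2 : ((k : ℝ) + 1) ^ (-a) = (1 + z) ^ (-a) * (((k : ℝ) + 1) / (1 + z)) ^ (-a) := by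
      rw [← Real.mul_rpow (by positivity) (by positivity), mul_div_cancel₀ _ h1z.ne']
    rw [h2, mul_assoc]
    refine mul_le_mul_of_nonneg_left ?_ (by positivity)
    have hz2 : 0 ≤ z ^ (2 * k) / ((2 * k)! : ℝ) := by positivity
    have hfac : (((2 * k + q)! : ℕ) : ℝ) ≤ q ! * ((2 * k + 1) ^ q * (2 * k)!) := by
      exact_mod_cast factorial_add_le (2 * k) q
    calc (((k : ℝ) + 1) / (1 + z)) ^ (-a) * (z ^ (2 * k) / ((2 * k)! : ℝ))
        ≤ (((k : ℝ) + 1) / (1 + z) + ((((k : ℝ) + 1) / (1 + z)) ^ q)⁻¹) *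
            (z ^ (2 * k) / ((2 * k)! : ℝ)) := by gcongr
      _ = ((k : ℝ) + 1) * z ^ (2 * k) / ((2 * k)! : ℝ) * (1 + z)⁻¹ +
          (1 + z) ^ q * (z ^ (2 * k) * (((k : ℝ) + 1) ^ q * ((2 * k)! : ℝ))⁻¹) := by
          rw [div_pow, inv_div]
          field_simp
      _ ≤ F (2 * k) := by
          rw [hF]
          simp only
          push_cast
          refine add_le_add (by gcongr; linarith) ?_
          rw [mul_comm (2 ^ q * (q ! : ℝ)), mul_assoc]
          refine mul_le_mul_of_nonneg_left ?_ (by positivity)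
          rw [mul_div_assoc', mul_comm _ (z ^ (2 * k)), mul_div_assoc]
          refine mul_le_mul_of_nonneg_left ?_ (by positivity)
          rw [inv_le_iff_one_le_mul₀ (by positivity), div_mul_eq_mul_div,
            one_le_div (by positivity)]
          refine hfac.trans ?_
          have : (2 * (k : ℝ) + 1) ^ q ≤ 2 ^ q * ((k : ℝ) + 1) ^ q := by
            rw [← mul_pow]; gcongr; linarith
          calc (q ! : ℝ) * ((2 * (k : ℝ) + 1) ^ q * ((2 * k)! : ℝ))
              ≤ q ! * ((2 ^ q * ((k : ℝ) + 1) ^ q) * ((2 * k)! : ℝ)) := by gcongr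
            _ = _ := by ring
  calc ∑ k ∈ Finset.range N, ((k : ℝ) + 1) ^ (-a) * (z ^ (2 * k) / ((2 * k)! : ℝ))
      ≤ ∑ k ∈ Finset.range N, (1 + z) ^ (-a) * F (2 * k) := Finset.sum_le_sum fun k _ => key k
    _ = (1 + z) ^ (-a) * ∑ k ∈ Finset.range N, F (2 * k) := by rw [Finset.mul_sum]
    _ ≤ (1 + z) ^ (-a) * ∑ m ∈ Finset.range (2 * N), F m := by
        gcongr
        exact sum_range_two_mul_le (fun m => by simp only [hF]; positivity) N
    _ = (1 + z) ^ (-a) * ((∑ m ∈ Finset.range (2 * N), ((m : ℝ) + 1) * z ^ m / (m ! : ℝ)) *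
          (1 + z)⁻¹ + 2 ^ q * q ! *
          ((1 + z) ^ q * ∑ m ∈ Finset.range (2 * N), z ^ m / ((m + q)! : ℝ))) := by
        rw [hF, Finset.sum_add_distrib, ← Finset.sum_mul, ← Finset.mul_sum]
        ring
    _ ≤ (1 + z) ^ (-a) * ((1 + z) * Real.exp z * (1 + z)⁻¹ +
          2 ^ q * q ! * (2 ^ q * Real.exp z)) := by
        refine mul_le_mul_of_nonneg_left (add_le_add ?_ ?_) (by positivity)
        · exact mul_le_mul_of_nonneg_right (sum_succ_mul_pow_div_factorial_le hz _) (by positivity)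
        · exact mul_le_mul_of_nonneg_left (sum_pow_div_factorial_add_le hz _ _) (by positivity)
    _ = _ := by field_simp

/-- The upper half of `I_ν(z) ≈ z ^ ν (1 + z) ^ (-ν - 1 / 2) e ^ z`. The power of `1 + z` gives
the kernel its sharp size near the diagonal, which is needed to compare it with averages. -/
theorem exists_modifiedBesselI_le {ν : ℝ} (hν : -1 < ν) :
    ∃ C : ℝ, 0 < C ∧ ∀ z : ℝ, 0 < z →
      modifiedBesselI ν z ≤ C * z ^ ν * (1 + z) ^ (-(ν + 1 / 2)) * Real.exp z := by
  obtain ⟨C₁, hC₁, h₁⟩ := Real.exists_inv_Gamma_natCast_add_le (s := ν + 1) (by linarith)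
  obtain ⟨C₂, hC₂, h₂⟩ := exists_sum_rpow_mul_pow_div_factorial_le (a := ν + 1 / 2) (by linarith)
  refine ⟨2 ^ (-ν) * C₁ * C₂, by positivity, fun z hz => ?_⟩
  have hG : ∀ k : ℕ, 0 < Real.Gamma ((k : ℝ) + ν + 1) := fun k =>
    Real.Gamma_pos_of_pos (by have : (0 : ℝ) ≤ k := k.cast_nonneg; linarith)
  refine Real.tsum_le_of_sum_range_le (fun k => ?_) (fun N => ?_)
  · have := hG k
    positivity
  have term : ∀ k : ℕ, (z / 2) ^ (2 * (k : ℝ) + ν) / ((k ! : ℝ) * Real.Gamma ((k : ℝ) + ν + 1)) ≤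
      (2 ^ (-ν) * z ^ ν * C₁) *
        (((k : ℝ) + 1) ^ (-(ν + 1 / 2)) * (z ^ (2 * k) / ((2 * k)! : ℝ))) := by
    intro k
    have hk := inv_factorial_sq_le k
    have hk1 := h₁ k
    have hz2 : (z / 2) ^ (2 * (k : ℝ) + ν) = (2 ^ (-ν) * z ^ ν) * (z ^ (2 * k) * (4 ^ k)⁻¹) := by
      rw [Real.rpow_add (by positivity), Real.div_rpow hz.le (by norm_num),
        Real.div_rpow hz.le (by norm_num), Real.rpow_neg (by norm_num),
        show (2 * (k : ℝ)) = ((2 * k : ℕ) : ℝ) by push_cast; ring, Real.rpow_natCast,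
        Real.rpow_natCast, pow_mul (2 : ℝ)]
      norm_num
      field_simp
    have e : ((k : ℝ) + 1) ^ (-(ν + 1 / 2)) =
        ((k : ℝ) + 1) ^ (1 - (ν + 1)) * ((k : ℝ) + 1) ^ (-(1 / 2) : ℝ) := by
      rw [← Real.rpow_add (by positivity)]; congr 1; ring
    rw [hz2, e]
    calc (2 ^ (-ν) * z ^ ν) * (z ^ (2 * k) * (4 ^ k)⁻¹) /
          ((k ! : ℝ) * Real.Gamma ((k : ℝ) + ν + 1))
        = (2 ^ (-ν) * z ^ ν) * (z ^ (2 * k) * (4 ^ k)⁻¹ * (k ! : ℝ)⁻¹) *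
          (Real.Gamma ((k : ℝ) + (ν + 1)))⁻¹ := by
          rw [← add_assoc, div_eq_mul_inv, mul_inv]; ring
      _ ≤ (2 ^ (-ν) * z ^ ν) * (z ^ (2 * k) * (4 ^ k)⁻¹ * (k ! : ℝ)⁻¹) *
          (C₁ * ((k : ℝ) + 1) ^ (1 - (ν + 1)) / (k ! : ℝ)) := by gcongr
      _ = (2 ^ (-ν) * z ^ ν * C₁ * ((k : ℝ) + 1) ^ (1 - (ν + 1)) * z ^ (2 * k)) *
          ((k ! : ℝ) ^ 2 * 4 ^ k)⁻¹ := by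
          rw [mul_inv]; field_simp
      _ ≤ (2 ^ (-ν) * z ^ ν * C₁ * ((k : ℝ) + 1) ^ (1 - (ν + 1)) * z ^ (2 * k)) *
          (((k : ℝ) + 1) ^ (-(1 / 2) : ℝ) / ((2 * k)! : ℝ)) := by gcongr
      _ = _ := by ring
  calc _ ≤ ∑ k ∈ Finset.range N, (2 ^ (-ν) * z ^ ν * C₁) *
        (((k : ℝ) + 1) ^ (-(ν + 1 / 2)) * (z ^ (2 * k) / ((2 * k)! : ℝ))) :=
        Finset.sum_le_sum fun k _ => term k
    _ = (2 ^ (-ν) * z ^ ν * C₁) * ∑ k ∈ Finset.range N,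
        (((k : ℝ) + 1) ^ (-(ν + 1 / 2)) * (z ^ (2 * k) / ((2 * k)! : ℝ))) := by
        rw [Finset.mul_sum]
    _ ≤ (2 ^ (-ν) * z ^ ν * C₁) * (C₂ * (1 + z) ^ (-(ν + 1 / 2)) * Real.exp z) := by
        gcongr
        exact h₂ z hz.le N
    _ = _ := by ring

theorem continuousOn_modifiedBesselI {ν : ℝ} (hν : -1 < ν) :
    ContinuousOn (modifiedBesselI ν) (Ioi 0) := by
  have hG : ∀ k : ℕ, 0 < Real.Gamma ((k : ℝ) + ν + 1) := fun k =>
    Real.Gamma_pos_of_pos (by have : (0 : ℝ) ≤ k := k.cast_nonneg; linarith)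
  -- without the factor `(z / 2) ^ ν` the terms are increasing in `z`, hence bounded near `z₀` by
  -- their values at `z₀ + 1`
  have hfac : ∀ z ∈ Ioi (0 : ℝ), modifiedBesselI ν z = (z / 2) ^ ν *
      ∑' k : ℕ, (z / 2) ^ (2 * k) / ((k ! : ℝ) * Real.Gamma ((k : ℝ) + ν + 1)) := by
    intro z hz
    have hz : 0 < z := hz
    rw [modifiedBesselI, ← tsum_mul_left]
    congr 1 with k
    rw [Real.rpow_add (by positivity), show (2 * (k : ℝ)) = ((2 * k : ℕ) : ℝ) by push_cast; ring,
      Real.rpow_natCast]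
    ring
  refine ContinuousOn.congr (ContinuousOn.mul ?_ ?_) hfac
  · refine ContinuousOn.rpow_const (by fun_prop) fun z hz => Or.inl ?_
    have hz : 0 < z := hz
    positivity
  · intro z₀ hz₀
    have hz₀ : 0 < z₀ := hz₀
    have hc : ContinuousOn (fun z : ℝ => ∑' k : ℕ, (z / 2) ^ (2 * k) /
        ((k ! : ℝ) * Real.Gamma ((k : ℝ) + ν + 1))) (Ioo 0 (z₀ + 1)) := by
      refine continuousOn_tsum (u := fun k : ℕ => ((z₀ + 1) / 2) ^ (2 * k) /
        ((k ! : ℝ) * Real.Gamma ((k : ℝ) + ν + 1))) (fun k => by fun_prop) ?_ ?_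
      · have h := (summable_modifiedBesselI hν (z := z₀ + 1) (by positivity)).mul_left
          (((z₀ + 1) / 2) ^ (-ν))
        refine h.congr fun k => ?_
        rw [mul_div_assoc', ← Real.rpow_add (by positivity), ← Real.rpow_natCast]
        congr 2
        push_cast; ring
      · intro k z hz
        have := hG k
        have hz0 := hz.1
        rw [Real.norm_of_nonneg (by positivity)]
        gcongr
        exact hz.2.le
    exact (hc.continuousAt (Ioo_mem_nhds hz₀ (by linarith))).continuousWithinAt

theorem modifiedBesselI_nonneg {ν z : ℝ} (hν : -1 < ν) (hz : 0 < z) : 0 ≤ modifiedBesselI ν z := by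
  refine tsum_nonneg fun k => ?_
  have : 0 < Real.Gamma ((k : ℝ) + ν + 1) :=
    Real.Gamma_pos_of_pos (by have : (0 : ℝ) ≤ k := k.cast_nonneg; linarith)
  positivity

/-! ### The heat kernel and the measure in one dimension -/

/-- If `a` and `b` are comparable up to a factor `κ`, then their powers of any real exponent `l`,
of either sign, are comparable up to the factor `κ ^ |l|`. -/
theorem rpow_le_rpow_abs_mul {a b κ : ℝ} (l : ℝ) (ha : 0 < a) (hb : 0 < b) (hab : a ≤ κ * b)
    (hba : b ≤ κ * a) : a ^ l ≤ κ ^ |l| * b ^ l := by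
  have hκ : 0 < κ := pos_of_mul_pos_left (ha.trans_le hab) hb.le
  rcases le_total 0 l with hl | hl
  · rw [abs_of_nonneg hl, ← Real.mul_rpow hκ.le hb.le]
    exact Real.rpow_le_rpow ha.le hab hl
  · rw [abs_of_nonpos hl, Real.rpow_neg hκ.le, ← Real.inv_rpow hκ.le,
      ← Real.mul_rpow (by positivity) hb.le]
    refine Real.rpow_le_rpow_of_nonpos (by positivity) ?_ hl
    rw [inv_mul_le_iff₀ hκ]
    exact hba

theorem exists_besselHeatKernel_le {l : ℝ} (hl : -(1 / 2 : ℝ) < l) :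
    ∃ C : ℝ, 0 < C ∧ ∀ s x y : ℝ, 0 < s → 0 < x → 0 < y →
      besselHeatKernel l s x y ≤
        C * (√s)⁻¹ * (2 * s + x * y) ^ (-l) * Real.exp (-(x - y) ^ 2 / (4 * s)) := by
  obtain ⟨C, hC, h⟩ := exists_modifiedBesselI_le (ν := l - 1 / 2) (by linarith)
  refine ⟨C, hC, fun s x y hs hx hy => ?_⟩
  have hz : 0 < x * y / (2 * s) := by positivity
  have hxy : 0 < x * y := by positivity
  have h2s : 0 < 2 * s := by positivity
  have hI := h _ hz
  have e1 : (x * y) ^ (-l + 1 / 2) * (x * y / (2 * s)) ^ (l - 1 / 2) = (2 * s) ^ (1 / 2 - l) := by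
    rw [Real.div_rpow hxy.le h2s.le, mul_div_assoc', ← Real.rpow_add hxy,
      show -l + 1 / 2 + (l - 1 / 2) = 0 by ring, Real.rpow_zero, one_div,
      ← Real.rpow_neg h2s.le]
    congr 1; ring
  have e2 : (1 + x * y / (2 * s)) ^ (-(l - 1 / 2 + 1 / 2)) =
      (2 * s) ^ l * (2 * s + x * y) ^ (-l) := by
    rw [show 1 + x * y / (2 * s) = (2 * s + x * y) / (2 * s) by field_simp,
      Real.div_rpow (by positivity) h2s.le, show -(l - 1 / 2 + 1 / 2) = -l by ring,
      Real.rpow_neg h2s.le, div_inv_eq_mul, mul_comm]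
  have e3 : Real.exp (x * y / (2 * s)) * Real.exp (-(x ^ 2 + y ^ 2) / (4 * s)) =
      Real.exp (-(x - y) ^ 2 / (4 * s)) := by
    rw [← Real.exp_add]; congr 1; field_simp; ring
  have e4 : (2 * s) ^ (1 / 2 - l) * (2 * s) ^ l / (2 * s) ≤ (√s)⁻¹ := by
    rw [← Real.rpow_add h2s, sub_add_cancel, ← Real.sqrt_eq_rpow, Real.sqrt_div_self]
    have : √s ≤ √(2 * s) := Real.sqrt_le_sqrt (by linarith)
    have := Real.sqrt_pos.2 hs
    gcongr
  rw [besselHeatKernel]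
  calc (x * y) ^ (-l + 1 / 2) / (2 * s) * modifiedBesselI (l - 1 / 2) (x * y / (2 * s)) *
          Real.exp (-(x ^ 2 + y ^ 2) / (4 * s))
      ≤ (x * y) ^ (-l + 1 / 2) / (2 * s) * (C * (x * y / (2 * s)) ^ (l - 1 / 2) *
          (1 + x * y / (2 * s)) ^ (-(l - 1 / 2 + 1 / 2)) * Real.exp (x * y / (2 * s))) *
          Real.exp (-(x ^ 2 + y ^ 2) / (4 * s)) := by gcongr
    _ = C * (((x * y) ^ (-l + 1 / 2) * (x * y / (2 * s)) ^ (l - 1 / 2)) *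
          (1 + x * y / (2 * s)) ^ (-(l - 1 / 2 + 1 / 2)) / (2 * s)) *
          (Real.exp (x * y / (2 * s)) * Real.exp (-(x ^ 2 + y ^ 2) / (4 * s))) := by ring
    _ = C * ((2 * s) ^ (1 / 2 - l) * (2 * s) ^ l / (2 * s)) * (2 * s + x * y) ^ (-l) *
          Real.exp (-(x - y) ^ 2 / (4 * s)) := by rw [e1, e2, e3]; ring
    _ ≤ _ := by gcongr

/-- The one-dimensional measure `x ^ (2 l) dx` on `(0, ∞)`, viewed as a measure on `ℝ`; the
factors of `besselMeasure` are of this form. -/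
noncomputable def besselMeasureLine (l : ℝ) : Measure ℝ :=
  (volume.restrict (Ioi (0 : ℝ))).withDensity fun x => ENNReal.ofReal (x ^ (2 * l))

theorem besselMeasureLine_apply {l : ℝ} {s : Set ℝ} (hs : MeasurableSet s) :
    besselMeasureLine l s = ∫⁻ x in s ∩ Ioi 0, ENNReal.ofReal (x ^ (2 * l)) := by
  rw [besselMeasureLine, withDensity_apply _ hs, Measure.restrict_restrict hs]

/-- Together with `exists_le_besselMeasureLine_ball`: the ball `(x - R, x + R)` has measure
comparable to `R (x + R) ^ (2 l)`. For `R ≤ x / 2` the density is constant on the ball up to a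
bounded factor, and for `R > x / 2` the ball is not much smaller than `(0, x + R)`. -/
theorem exists_besselMeasureLine_ball_le {l : ℝ} (hl : -(1 / 2 : ℝ) < l) :
    ∃ C : ℝ, 0 < C ∧ ∀ x R : ℝ, 0 < x → 0 < R →
      besselMeasureLine l (Metric.ball x R) ≤ ENNReal.ofReal (C * (R * (x + R) ^ (2 * l))) := by
  have hl1 : 0 < 2 * l + 1 := by linarith
  refine ⟨2 * 3 ^ |2 * l| + 3 / (2 * l + 1), by positivity, fun x R hx hR => ?_⟩
  rw [besselMeasureLine_apply measurableSet_ball, Real.ball_eq_Ioo]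
  have hxR : 0 < x + R := by positivity
  rcases le_total R (x / 2) with h | h
  · calc ∫⁻ u in Ioo (x - R) (x + R) ∩ Ioi 0, ENNReal.ofReal (u ^ (2 * l))
        ≤ ∫⁻ u in Ioo (x - R) (x + R) ∩ Ioi 0,
            ENNReal.ofReal (3 ^ |2 * l| * (x + R) ^ (2 * l)) := by
          refine setLIntegral_mono measurable_const fun u hu => ENNReal.ofReal_le_ofReal ?_
          have h0 : 0 < u := hu.2
          have h1 := hu.1.1
          have h2 := hu.1.2
          exact rpow_le_rpow_abs_mul _ h0 hxR (by linarith) (by linarith)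
      _ = ENNReal.ofReal (3 ^ |2 * l| * (x + R) ^ (2 * l)) *
            volume (Ioo (x - R) (x + R) ∩ Ioi 0) := by
          rw [setLIntegral_const]
      _ ≤ ENNReal.ofReal (3 ^ |2 * l| * (x + R) ^ (2 * l)) * volume (Ioo (x - R) (x + R)) := by
          gcongr; exact inter_subset_left
      _ = ENNReal.ofReal (2 * 3 ^ |2 * l| * (R * (x + R) ^ (2 * l))) := by
          rw [Real.volume_Ioo, ← ENNReal.ofReal_mul (by positivity)]
          congr 1; ring
      _ ≤ _ := by
          gcongr
          have : 0 ≤ 3 / (2 * l + 1) := by positivity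
          linarith
  · calc ∫⁻ u in Ioo (x - R) (x + R) ∩ Ioi 0, ENNReal.ofReal (u ^ (2 * l))
        ≤ ∫⁻ u in Ioc 0 (x + R), ENNReal.ofReal (u ^ (2 * l)) :=
          lintegral_mono_set fun u hu => ⟨hu.2, hu.1.2.le⟩
      _ = ENNReal.ofReal (∫ u in (0)..(x + R), u ^ (2 * l)) := by
          rw [intervalIntegral.integral_of_le hxR.le, ofReal_integral_eq_lintegral_ofReal]
          · exact (intervalIntegral.intervalIntegrable_rpow' (by linarith)).1
          · filter_upwards [ae_restrict_mem measurableSet_Ioc] with u hu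
            have := hu.1
            positivity
      _ = ENNReal.ofReal ((x + R) * (x + R) ^ (2 * l) / (2 * l + 1)) := by
          rw [integral_rpow (Or.inl (by linarith)), Real.zero_rpow hl1.ne',
            Real.rpow_add_one hxR.ne']
          congr 1; ring
      _ ≤ ENNReal.ofReal (3 / (2 * l + 1) * (R * (x + R) ^ (2 * l))) := by
          refine ENNReal.ofReal_le_ofReal ?_
          rw [div_mul_eq_mul_div]
          rw [← mul_assoc]
          gcongr
          linarith
      _ ≤ _ := by
          gcongr
          have : 0 ≤ 2 * (3 : ℝ) ^ |2 * l| := by positivity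
          linarith

theorem exists_le_besselMeasureLine_ball (l : ℝ) :
    ∃ c : ℝ, 0 < c ∧ ∀ x R : ℝ, 0 < x → 0 < R →
      ENNReal.ofReal (c * (R * (x + R) ^ (2 * l))) ≤ besselMeasureLine l (Metric.ball x R) := by
  refine ⟨(2 ^ |2 * l|)⁻¹ / 2, by positivity, fun x R hx hR => ?_⟩
  have hxR : 0 < x + R := by positivity
  rw [besselMeasureLine_apply measurableSet_ball, Real.ball_eq_Ioo]
  calc ENNReal.ofReal ((2 ^ |2 * l|)⁻¹ / 2 * (R * (x + R) ^ (2 * l)))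
      = ENNReal.ofReal ((2 ^ |2 * l|)⁻¹ * (x + R) ^ (2 * l)) *
          volume (Ioo (x + R / 2) (x + R)) := by
        rw [Real.volume_Ioo, ← ENNReal.ofReal_mul (by positivity)]
        congr 1; ring
    _ = ∫⁻ u in Ioo (x + R / 2) (x + R), ENNReal.ofReal ((2 ^ |2 * l|)⁻¹ * (x + R) ^ (2 * l)) := by
        rw [setLIntegral_const]
    _ ≤ ∫⁻ u in Ioo (x + R / 2) (x + R), ENNReal.ofReal (u ^ (2 * l)) := by
        refine setLIntegral_mono (by fun_prop) fun u hu => ENNReal.ofReal_le_ofReal ?_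
        have h1 := hu.1
        have h2 := hu.2
        rw [inv_mul_le_iff₀ (by positivity)]
        exact rpow_le_rpow_abs_mul _ hxR (by linarith) (by linarith) (by linarith)
    _ ≤ _ := by
        refine lintegral_mono_set fun u hu => ⟨⟨?_, hu.2⟩, ?_⟩
        · linarith [hu.1]
        · exact lt_trans (by positivity) hu.1

theorem besselMeasureLine_ball_pos {l x R : ℝ} (hx : 0 < x) (hR : 0 < R) :
    0 < besselMeasureLine l (Metric.ball x R) := by
  obtain ⟨c, hc, h⟩ := exists_le_besselMeasureLine_ball l
  refine lt_of_lt_of_le ?_ (h x R hx hR)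
  rw [ENNReal.ofReal_pos]
  positivity

theorem besselMeasureLine_ball_lt_top {l x R : ℝ} (hl : -(1 / 2 : ℝ) < l) (hx : 0 < x)
    (hR : 0 < R) : besselMeasureLine l (Metric.ball x R) < ∞ := by
  obtain ⟨C, hC, h⟩ := exists_besselMeasureLine_ball_le hl
  exact (h x R hx hR).trans_lt ENNReal.ofReal_lt_top

/-- The doubling property, with the dependence on the dilation factor `κ` made explicit. -/
theorem exists_besselMeasureLine_ball_mul_le {l : ℝ} (hl : -(1 / 2 : ℝ) < l) :
    ∃ (D : ℝ) (M : ℕ), 0 < D ∧ ∀ x R κ : ℝ, 0 < x → 0 < R → 1 ≤ κ →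
      besselMeasureLine l (Metric.ball x (κ * R)) ≤
        ENNReal.ofReal (D * κ ^ M) * besselMeasureLine l (Metric.ball x R) := by
  obtain ⟨C, hC, hle⟩ := exists_besselMeasureLine_ball_le hl
  obtain ⟨c, hc, hge⟩ := exists_le_besselMeasureLine_ball l
  obtain ⟨M, hM⟩ := exists_nat_ge (1 + |2 * l|)
  refine ⟨C / c, M, by positivity, fun x R κ hx hR hκ => ?_⟩
  have hκ0 : 0 < κ := by linarith
  calc besselMeasureLine l (Metric.ball x (κ * R))
      ≤ ENNReal.ofReal (C * (κ * R * (x + κ * R) ^ (2 * l))) := hle x _ hx (by positivity)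
    _ ≤ ENNReal.ofReal ((C / c * κ ^ M) * (c * (R * (x + R) ^ (2 * l)))) := by
        refine ENNReal.ofReal_le_ofReal ?_
        have h1 : (x + κ * R) ^ (2 * l) ≤ κ ^ |2 * l| * (x + R) ^ (2 * l) :=
          rpow_le_rpow_abs_mul _ (by positivity) (by positivity) (by nlinarith)
            (by nlinarith [mul_nonneg (sub_nonneg.2 hκ) hx.le,
              mul_nonneg (sub_nonneg.2 hκ) (mul_pos hκ0 hR).le,
              mul_nonneg (sub_nonneg.2 hκ) hR.le])
        have h2 : κ * κ ^ |2 * l| ≤ κ ^ M := by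
          rw [← Real.rpow_natCast, ← Real.rpow_one_add' hκ0.le (by positivity)]
          exact Real.rpow_le_rpow_of_exponent_le hκ hM
        calc C * (κ * R * (x + κ * R) ^ (2 * l))
            ≤ C * (κ * R * (κ ^ |2 * l| * (x + R) ^ (2 * l))) := by gcongr
          _ = C * ((κ * κ ^ |2 * l|) * R * (x + R) ^ (2 * l)) := by ring
          _ ≤ C * (κ ^ M * R * (x + R) ^ (2 * l)) := by gcongr
          _ = _ := by field_simp
    _ = ENNReal.ofReal (C / c * κ ^ M) * ENNReal.ofReal (c * (R * (x + R) ^ (2 * l))) := by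
        rw [ENNReal.ofReal_mul (by positivity)]
    _ ≤ _ := by gcongr; exact hge x R hx hR

/-- Gaussian bound of the kernel relative to the measure of a ball with centre `x` that contains
`y`; its radius may be any multiple `κ ≥ 1` of the natural scale `√s`, at the cost of a power of
`κ`. -/
theorem exists_besselHeatKernel_mul_ball_le {l : ℝ} (hl : -(1 / 2 : ℝ) < l) :
    ∃ (A : ℝ) (M : ℕ), 0 < A ∧ ∀ s x y κ : ℝ, 0 < s → 0 < x → 0 < y → 1 ≤ κ → |x - y| < κ * √s →
      ENNReal.ofReal (besselHeatKernel l s x y) * besselMeasureLine l (Metric.ball x (κ * √s)) ≤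
        ENNReal.ofReal (A * κ ^ M * Real.exp (-(x - y) ^ 2 / (4 * s))) := by
  obtain ⟨C, hC, hle⟩ := exists_besselMeasureLine_ball_le hl
  obtain ⟨C', hC', hW⟩ := exists_besselHeatKernel_le hl
  obtain ⟨M, hM⟩ := exists_nat_ge (1 + |2 * l|)
  refine ⟨C * C' * 9 ^ |l|, M, by positivity, fun s x y κ hs hx hy hκ hxy => ?_⟩
  have hκ0 : 0 < κ := by linarith
  have hρ : 0 < √s := Real.sqrt_pos.2 hs
  have hs' : s = √s * √s := (Real.mul_self_sqrt hs.le).symm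
  obtain ⟨hxy1, hxy2⟩ := abs_lt.1 hxy
  have hκs : s ≤ κ ^ 2 * s := by
    have : 1 ≤ κ ^ 2 := one_le_pow₀ hκ
    nlinarith
  have hsq : (κ * √s) ^ 2 = κ ^ 2 * s := by rw [mul_pow, Real.sq_sqrt hs.le]
  -- `ha` and `hb`: the bases `(x + κ √s) ^ 2` and `2 s + x y` of the powers in the measure of the ball
  -- and in the kernel are comparable; for `ha`, either `x ≤ 2 κ √s` or `y ≥ x / 2`
  have ha : (x + κ * √s) ^ 2 ≤ 9 * κ ^ 2 * (2 * s + x * y) := by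
    have h1 : 1 ≤ κ ^ 2 := one_le_pow₀ hκ
    have hp : 0 < κ * √s := by positivity
    have hxyp : 0 < x * y := by positivity
    rcases le_total x (2 * (κ * √s)) with h | h
    · have : (x + κ * √s) ^ 2 ≤ (3 * (κ * √s)) ^ 2 := by gcongr; linarith
      rw [mul_pow, hsq] at this
      nlinarith [mul_pos (pow_pos hκ0 2) hxyp, mul_pos (pow_pos hκ0 2) hs]
    · have h3 : (x + κ * √s) ^ 2 ≤ (3 / 2 * x) ^ 2 := by gcongr; linarith
      have h4 : x * x ≤ 2 * (x * y) := by nlinarith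
      nlinarith [mul_pos (pow_pos hκ0 2) hs, mul_nonneg (sub_nonneg.2 h1) hxyp.le]
  have hb : 2 * s + x * y ≤ 9 * κ ^ 2 * (x + κ * √s) ^ 2 := by
    have h1 : 1 ≤ κ ^ 2 := one_le_pow₀ hκ
    have h2 : x * y ≤ x * (x + κ * √s) := by gcongr; linarith
    have h3 : 2 * s + x * y ≤ 2 * (x + κ * √s) ^ 2 := by
      have : 0 < x * (κ * √s) := by positivity
      nlinarith
    nlinarith [mul_nonneg (sub_nonneg.2 h1) (sq_nonneg (x + κ * √s)), sq_nonneg (x + κ * √s)]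
  have hpow : (x + κ * √s) ^ (2 * l) * (2 * s + x * y) ^ (-l) ≤ 9 ^ |l| * κ ^ |2 * l| := by
    have h := rpow_le_rpow_abs_mul l (by positivity) (by positivity) ha hb
    have e1 : ((x + κ * √s) ^ 2) ^ l = (x + κ * √s) ^ (2 * l) := by
      rw [← Real.rpow_natCast, ← Real.rpow_mul (by positivity)]; norm_num
    have e2 : (9 * κ ^ 2) ^ |l| = 9 ^ |l| * κ ^ |2 * l| := by
      rw [Real.mul_rpow (by norm_num) (by positivity), ← Real.rpow_natCast,
        ← Real.rpow_mul (by positivity), abs_mul]; norm_num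
    rw [e1, e2] at h
    rw [Real.rpow_neg (by positivity), ← div_eq_mul_inv, div_le_iff₀ (by positivity)]
    exact h
  have h2 : κ * κ ^ |2 * l| ≤ κ ^ M := by
    rw [← Real.rpow_natCast, ← Real.rpow_one_add' hκ0.le (by positivity)]
    exact Real.rpow_le_rpow_of_exponent_le hκ hM
  calc ENNReal.ofReal (besselHeatKernel l s x y) * besselMeasureLine l (Metric.ball x (κ * √s))
      ≤ ENNReal.ofReal (C' * (√s)⁻¹ * (2 * s + x * y) ^ (-l) *
          Real.exp (-(x - y) ^ 2 / (4 * s))) *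
          ENNReal.ofReal (C * (κ * √s * (x + κ * √s) ^ (2 * l))) := by
        gcongr
        · exact hW s x y hs hx hy
        · exact hle x _ hx (by positivity)
    _ = ENNReal.ofReal ((C * C' * κ * ((x + κ * √s) ^ (2 * l) * (2 * s + x * y) ^ (-l))) *
          Real.exp (-(x - y) ^ 2 / (4 * s))) := by
        rw [← ENNReal.ofReal_mul (by positivity)]
        congr 1
        field_simp
    _ ≤ ENNReal.ofReal ((C * C' * κ * (9 ^ |l| * κ ^ |2 * l|)) *
          Real.exp (-(x - y) ^ 2 / (4 * s))) := by gcongr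
    _ = ENNReal.ofReal ((C * C' * 9 ^ |l| * (κ * κ ^ |2 * l|)) *
          Real.exp (-(x - y) ^ 2 / (4 * s))) := by congr 1; ring
    _ ≤ _ := by gcongr

theorem besselHeatKernel_nonneg {l s x y : ℝ} (hl : -(1 / 2 : ℝ) < l) (hs : 0 < s) (hx : 0 < x)
    (hy : 0 < y) : 0 ≤ besselHeatKernel l s x y := by
  have := modifiedBesselI_nonneg (ν := l - 1 / 2) (z := x * y / (2 * s)) (by linarith)
    (by positivity)
  rw [besselHeatKernel]
  positivity

theorem continuousOn_besselHeatKernel {l : ℝ} (hl : -(1 / 2 : ℝ) < l) :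
    ContinuousOn (fun q : ℝ × ℝ × ℝ => besselHeatKernel l q.1 q.2.1 q.2.2)
      (Ioi 0 ×ˢ Ioi 0 ×ˢ Ioi 0) := by
  simp only [besselHeatKernel]
  have h2 : ∀ q ∈ Ioi (0 : ℝ) ×ˢ Ioi (0 : ℝ) ×ˢ Ioi (0 : ℝ), 0 < q.1 ∧ 0 < q.2.1 ∧ 0 < q.2.2 :=
    fun q hq => ⟨hq.1, hq.2.1, hq.2.2⟩
  refine ((ContinuousOn.div ?_ (by fun_prop) ?_).mul ?_).mul ?_
  · refine ContinuousOn.rpow_const (by fun_prop) fun q hq => Or.inl ?_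
    obtain ⟨h₁, h₂, h₃⟩ := h2 q hq
    positivity
  · intro q hq
    obtain ⟨h₁, h₂, h₃⟩ := h2 q hq
    positivity
  · refine (continuousOn_modifiedBesselI (ν := l - 1 / 2) (by linarith)).comp
      (ContinuousOn.div (by fun_prop) (by fun_prop) ?_) ?_
    · intro q hq
      obtain ⟨h₁, h₂, h₃⟩ := h2 q hq
      positivity
    · intro q hq
      obtain ⟨h₁, h₂, h₃⟩ := h2 q hq
      simp only [mem_Ioi]
      positivity
  · refine ContinuousOn.rexp (ContinuousOn.div (by fun_prop) (by fun_prop) ?_)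
    intro q hq
    obtain ⟨h₁, h₂, h₃⟩ := h2 q hq
    positivity

/-! ### Maximal functions over one-parameter families of sets -/

/-- The finite Vitali covering selection: repeatedly pick a set of largest size and discard all
those that meet it. -/
theorem Finset.exists_pairwiseDisjoint_covering {ι X : Type*} (R : ι → Set X) (δ : ι → ℝ)
    (hR : ∀ i, (R i).Nonempty) (s : Finset ι) :
    ∃ u ⊆ s, (u : Set ι).PairwiseDisjoint R ∧
      ∀ i ∈ s, ∃ j ∈ u, (R i ∩ R j).Nonempty ∧ δ i ≤ δ j := by
  classical
  induction s using Finset.strongInduction with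
  | H s ih =>
    rcases s.eq_empty_or_nonempty with rfl | hs
    · exact ⟨∅, by simp⟩
    obtain ⟨j, hj, hmax⟩ := s.exists_max_image δ hs
    have hss : s.filter (fun i => Disjoint (R i) (R j)) ⊂ s := by
      refine Finset.filter_ssubset.2 ⟨j, hj, fun h => (hR j).ne_empty (disjoint_self.1 h)⟩
    obtain ⟨u, hus, hdisj, hcov⟩ := ih _ hss
    refine ⟨insert j u, ?_, ?_, ?_⟩
    · exact Finset.insert_subset hj (hus.trans (Finset.filter_subset _ _))
    · rw [Finset.coe_insert]
      refine hdisj.insert fun i hi _ => ?_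
      exact ((Finset.mem_filter.1 (hus hi)).2).symm
    · intro i hi
      by_cases h : Disjoint (R i) (R j)
      · obtain ⟨k, hk, hk'⟩ := hcov i (Finset.mem_filter.2 ⟨hi, h⟩)
        exact ⟨k, Finset.mem_insert_of_mem hk, hk'⟩
      · exact ⟨j, Finset.mem_insert_self _ _, Set.not_disjoint_iff_nonempty_inter.1 h, hmax i hi⟩

section Maximal

variable {X ι : Type*} [MeasurableSpace X] {μ : Measure X}

/-- The uncentred maximal function of `g` over the family of sets `R`: the supremum of the
averages of `g` over the sets `R i` containing the point. Null sets do not contribute, as the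
integral over them vanishes as well. -/
noncomputable def setMaximal (μ : Measure X) (R : ι → Set X) (g : X → ℝ≥0∞) (x : X) : ℝ≥0∞ :=
  ⨆ i, ⨆ _ : x ∈ R i, (∫⁻ y in R i, g y ∂μ) / μ (R i)

theorem le_setMaximal {R : ι → Set X} {g : X → ℝ≥0∞} {x : X} {i : ι} (hx : x ∈ R i) :
    (∫⁻ y in R i, g y ∂μ) / μ (R i) ≤ setMaximal μ R g x :=
  le_iSup₂ (f := fun i (_ : x ∈ R i) => (∫⁻ y in R i, g y ∂μ) / μ (R i)) i hx

theorem setOf_lt_setMaximal (R : ι → Set X) (g : X → ℝ≥0∞) (γ : ℝ≥0∞) :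
    {x | γ < setMaximal μ R g x} =
      ⋃ i : {i // γ < (∫⁻ y in R i, g y ∂μ) / μ (R i)}, R i := by
  ext x
  simp only [setMaximal, mem_ofPred_eq, lt_iSup_iff, mem_iUnion, Subtype.exists, exists_prop]
  exact exists_congr fun i => and_comm

theorem setMaximal_mono_ae {R : ι → Set X} {g h : X → ℝ≥0∞} (hgh : g ≤ᵐ[μ] h) (x : X) :
    setMaximal μ R g x ≤ setMaximal μ R h x := by
  refine iSup₂_mono fun i _ => ENNReal.div_le_div_right ?_ _
  exact lintegral_mono_ae (ae_restrict_of_ae hgh)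

theorem setMaximal_add_le {R : ι → Set X} {g h : X → ℝ≥0∞} (hg : AEMeasurable g μ) (x : X) :
    setMaximal μ R (fun y => g y + h y) x ≤ setMaximal μ R g x + setMaximal μ R h x := by
  refine iSup₂_le fun i hi => ?_
  rw [lintegral_add_left' hg.restrict, ENNReal.add_div]
  exact add_le_add (le_setMaximal hi) (le_setMaximal hi)

theorem setMaximal_const_le {R : ι → Set X} (c : ℝ≥0∞) (x : X) :
    setMaximal μ R (fun _ => c) x ≤ c := by
  refine iSup₂_le fun i _ => ?_
  rw [setLIntegral_const]
  exact ENNReal.div_le_of_le_mul le_rfl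

variable [TopologicalSpace X] [OpensMeasurableSpace X]

theorem measurable_setMaximal {R : ι → Set X} (hR : ∀ i, IsOpen (R i)) (g : X → ℝ≥0∞) :
    Measurable (setMaximal μ R g) := by
  refine measurable_of_Ioi fun γ => ?_
  have : setMaximal μ R g ⁻¹' Ioi γ = {x | γ < setMaximal μ R g x} := rfl
  rw [this, setOf_lt_setMaximal]
  exact (isOpen_iUnion fun i => hR _).measurableSet

/-- Weak type `(1, 1)` of the maximal function over a family of open sets ordered by a size `δ`,
in which each set is contained in the enlargement `R' j` of any larger set `R j` that it meets.
The constant depends on the family only through the ratio of `μ (R' j)` to `μ (R j)`. -/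
theorem mul_measure_lt_setMaximal_le [SecondCountableTopology X] {R R' : ι → Set X}
    (δ : ι → ℝ) {D : ℝ≥0∞}
    (hopen : ∀ i, IsOpen (R i)) (hne : ∀ i, (R i).Nonempty)
    (hengulf : ∀ i j, (R i ∩ R j).Nonempty → δ i ≤ δ j → R i ⊆ R' j)
    (hD : ∀ i, μ (R' i) ≤ D * μ (R i)) (g : X → ℝ≥0∞) (γ : ℝ≥0∞) :
    γ * μ {x | γ < setMaximal μ R g x} ≤ D * ∫⁻ y, g y ∂μ := by
  rw [setOf_lt_setMaximal]
  set J := {i // γ < (∫⁻ y in R i, g y ∂μ) / μ (R i)}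
  obtain ⟨T, hTc, hT⟩ := TopologicalSpace.isOpen_iUnion_countable (fun i : J => R i)
    (fun i => hopen i)
  have hfin : ∀ s : Finset J, γ * μ (⋃ i ∈ s, R i) ≤ D * ∫⁻ y, g y ∂μ := by
    intro s
    obtain ⟨u, -, hdisj, hcov⟩ := Finset.exists_pairwiseDisjoint_covering
      (fun i : J => R i) (fun i => δ i) (fun i => hne i) s
    have hsub : (⋃ i ∈ s, R i) ⊆ ⋃ j ∈ u, R' j := by
      refine iUnion₂_subset fun i hi => ?_
      obtain ⟨j, hj, hij, hδ⟩ := hcov i hi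
      exact (hengulf i j hij hδ).trans (subset_biUnion_of_mem (u := fun j : J => R' j) hj)
    calc γ * μ (⋃ i ∈ s, R i) ≤ γ * ∑ j ∈ u, μ (R' j) := by
          gcongr
          exact (measure_mono hsub).trans (measure_biUnion_finset_le _ _)
      _ ≤ γ * ∑ j ∈ u, D * μ (R j) := by
          gcongr with j hj
          exact hD j
      _ = D * ∑ j ∈ u, γ * μ (R j) := by
          rw [Finset.mul_sum, Finset.mul_sum]
          exact Finset.sum_congr rfl fun j _ => by ring
      _ ≤ D * ∑ j ∈ u, ∫⁻ y in R j, g y ∂μ := by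
          gcongr with j hj
          exact ENNReal.mul_le_of_le_div j.2.le
      _ = D * ∫⁻ y in ⋃ j ∈ u, R j, g y ∂μ := by
          rw [lintegral_biUnion_finset hdisj fun j _ => (hopen j).measurableSet]
      _ ≤ D * ∫⁻ y, g y ∂μ := by
          gcongr
          exact Measure.restrict_le_self
  have hTc' : Countable T := hTc.to_subtype
  have hmono : Monotone fun s : Finset T => ⋃ i ∈ s, R (i : J) :=
    fun s t hst => biUnion_subset_biUnion_left hst
  rw [← hT, biUnion_eq_iUnion, iUnion_eq_iUnion_finset, hmono.measure_iUnion, ENNReal.mul_iSup]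
  refine iSup_le fun s => ?_
  simpa using hfin (s.map (Function.Embedding.subtype _))

end Maximal

/-! ### Interpolation between weak type `(1, 1)` and `L^∞` -/

section Interpolation

theorem setLIntegral_Ioo_rpow {r b : ℝ} (hr : -1 < r) (hb : 0 ≤ b) :
    ∫⁻ t in Ioo 0 b, ENNReal.ofReal (t ^ r) = ENNReal.ofReal (b ^ (r + 1) / (r + 1)) := by
  rw [setLIntegral_congr Ioo_ae_eq_Ioc, ← ofReal_integral_eq_lintegral_ofReal,
    ← intervalIntegral.integral_of_le hb, integral_rpow (Or.inl hr),
    Real.zero_rpow (by linarith), sub_zero]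
  · exact (intervalIntegral.intervalIntegrable_rpow' hr).1
  · filter_upwards [ae_restrict_mem measurableSet_Ioc] with u hu
    have := hu.1
    positivity

theorem lintegral_Ioi_ite_rpow {r b : ℝ} (hr : -1 < r) (hb : 0 ≤ b) :
    ∫⁻ t in Ioi (0 : ℝ),
        (if ENNReal.ofReal t < ENNReal.ofReal b then ENNReal.ofReal (t ^ r) else 0) =
      ENNReal.ofReal (b ^ (r + 1) / (r + 1)) := by
  rw [← setLIntegral_Ioo_rpow hr hb, ← lintegral_indicator measurableSet_Ioi,
    ← lintegral_indicator measurableSet_Ioo]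
  congr 1 with t
  by_cases ht : 0 < t
  · by_cases htb : t < b
    · have h1 : ENNReal.ofReal t < ENNReal.ofReal b :=
        (ENNReal.ofReal_lt_ofReal_iff_of_nonneg ht.le).2 htb
      simp [indicator, ht, htb, h1]
    · have h1 : ¬ ENNReal.ofReal t < ENNReal.ofReal b := fun h =>
        htb ((ENNReal.ofReal_lt_ofReal_iff_of_nonneg ht.le).1 h)
      simp [indicator, ht, htb, h1]
  · simp [indicator, ht]

/-- Upper half of the formula `∫ t in 0..a, t ^ r = a ^ (r + 1) / (r + 1)`, with `a = ∞` allowed. -/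
theorem lintegral_Ioi_ite_rpow_le {r : ℝ} (hr : -1 < r) (a : ℝ≥0∞) :
    ∫⁻ t in Ioi (0 : ℝ), (if ENNReal.ofReal t < a then ENNReal.ofReal (t ^ r) else 0) ≤
      a ^ (r + 1) / ENNReal.ofReal (r + 1) := by
  have hr1 : 0 < r + 1 := by linarith
  rcases eq_or_ne a ∞ with rfl | ha
  · rw [ENNReal.top_rpow_of_pos hr1, ENNReal.top_div_of_ne_top ENNReal.ofReal_ne_top]
    exact le_top
  · lift a to ℝ≥0 using ha
    have h := lintegral_Ioi_ite_rpow hr a.coe_nonneg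
    rw [ENNReal.ofReal_coe_nnreal] at h
    rw [h, ENNReal.ofReal_div_of_pos hr1, ← ENNReal.ofReal_rpow_of_nonneg a.coe_nonneg hr1.le,
      ENNReal.ofReal_coe_nnreal]

/-- Lower half of the formula `∫ t in 0..a, t ^ r = a ^ (r + 1) / (r + 1)`, with `a = ∞` allowed,
where it says that the integral diverges. -/
theorem rpow_le_lintegral_Ioi_ite {r : ℝ} (hr : -1 < r) (a : ℝ≥0∞) :
    a ^ (r + 1) ≤ ENNReal.ofReal (r + 1) *
      ∫⁻ t in Ioi (0 : ℝ), (if ENNReal.ofReal t < a then ENNReal.ofReal (t ^ r) else 0) := by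
  have hr1 : 0 < r + 1 := by linarith
  have hfin : ∀ b : ℝ≥0, (b : ℝ≥0∞) ≤ a → (b : ℝ≥0∞) ^ (r + 1) ≤ ENNReal.ofReal (r + 1) *
      ∫⁻ t in Ioi (0 : ℝ), (if ENNReal.ofReal t < a then ENNReal.ofReal (t ^ r) else 0) := by
    intro b hb
    have h := lintegral_Ioi_ite_rpow hr b.coe_nonneg
    rw [ENNReal.ofReal_coe_nnreal] at h
    calc (b : ℝ≥0∞) ^ (r + 1)
        = ENNReal.ofReal (r + 1) * ENNReal.ofReal ((b : ℝ) ^ (r + 1) / (r + 1)) := by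
          rw [← ENNReal.ofReal_mul hr1.le, mul_div_cancel₀ _ hr1.ne',
            ← ENNReal.ofReal_rpow_of_nonneg b.coe_nonneg hr1.le, ENNReal.ofReal_coe_nnreal]
      _ ≤ _ := by
          rw [← h]
          gcongr with t
          by_cases ht : ENNReal.ofReal t < b
          · simp [ht, ht.trans_le hb]
          · simp [ht]
  rcases eq_or_ne a ∞ with rfl | ha
  · rw [ENNReal.top_rpow_of_pos hr1]
    refine ENNReal.le_of_forall_nnreal_lt fun c _ => ?_
    refine le_trans (le_of_eq ?_) (hfin (c ^ (r + 1)⁻¹) le_top)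
    rw [ENNReal.coe_rpow_of_nonneg _ (by positivity), ENNReal.rpow_inv_rpow hr1.ne']
  · lift a to ℝ≥0 using ha
    exact hfin a le_rfl

/-- The integration step of Marcinkiewicz interpolation between weak type `(1, 1)` and `L^∞`: the
distribution function of `F` at height `t` is controlled by the part of `g` above height `t / B`. -/
theorem lintegral_rpow_le_of_measure_lt_le {X : Type*} [MeasurableSpace X] {μ : Measure X}
    [SFinite μ] {F g : X → ℝ≥0∞} (hF : Measurable F) (hg : Measurable g) {K B : ℝ≥0∞} {p : ℝ}
    (hp : 1 < p)
    (h : ∀ t : ℝ, 0 < t → ENNReal.ofReal t * μ {x | ENNReal.ofReal t < F x} ≤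
      K * ∫⁻ x in {x | ENNReal.ofReal t < B * g x}, g x ∂μ) :
    ∫⁻ x, F x ^ p ∂μ ≤
      ENNReal.ofReal p * K * (B ^ (p - 1) / ENNReal.ofReal (p - 1)) * ∫⁻ x, g x ^ p ∂μ := by
  have hp1 : 0 < p - 1 := by linarith
  calc ∫⁻ x, F x ^ p ∂μ
      ≤ ∫⁻ x, ENNReal.ofReal p * (∫⁻ t in Ioi (0 : ℝ),
          (if ENNReal.ofReal t < F x then ENNReal.ofReal (t ^ (p - 1)) else 0)) ∂μ := by
        gcongr with x
        simpa using rpow_le_lintegral_Ioi_ite (r := p - 1) (by linarith) (F x)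
    _ = ENNReal.ofReal p * ∫⁻ t in Ioi (0 : ℝ), ∫⁻ x,
          (if ENNReal.ofReal t < F x then ENNReal.ofReal (t ^ (p - 1)) else 0) ∂μ := by
        rw [lintegral_const_mul' _ _ ENNReal.ofReal_ne_top, lintegral_lintegral_swap]
        refine Measurable.aemeasurable ?_
        refine Measurable.ite (measurableSet_lt ?_ ?_) ?_ measurable_const <;> fun_prop
    _ ≤ ENNReal.ofReal p * ∫⁻ t in Ioi (0 : ℝ), K * ∫⁻ x,
          g x * (if ENNReal.ofReal t < B * g x then ENNReal.ofReal (t ^ (p - 2)) else 0) ∂μ := by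
        refine mul_le_mul_right (setLIntegral_mono' measurableSet_Ioi fun t ht => ?_) _
        have ht : 0 < t := ht
        have e1 : ∫⁻ x, (if ENNReal.ofReal t < F x then ENNReal.ofReal (t ^ (p - 1)) else 0) ∂μ =
            ENNReal.ofReal (t ^ (p - 1)) * μ {x | ENNReal.ofReal t < F x} := by
          rw [← lintegral_indicator_const (measurableSet_lt measurable_const hF)]
          congr 1 with x
          by_cases hx : ENNReal.ofReal t < F x <;> simp [indicator, hx]
        have e2 : ∫⁻ x, g x *
              (if ENNReal.ofReal t < B * g x then ENNReal.ofReal (t ^ (p - 2)) else 0) ∂μ =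
            ENNReal.ofReal (t ^ (p - 2)) * ∫⁻ x in {x | ENNReal.ofReal t < B * g x}, g x ∂μ := by
          rw [← lintegral_indicator (measurableSet_lt measurable_const (hg.const_mul B)),
            ← lintegral_const_mul' _ _ ENNReal.ofReal_ne_top]
          congr 1 with x
          by_cases hx : ENNReal.ofReal t < B * g x <;> simp [indicator, hx, mul_comm]
        rw [e1, e2, show p - 1 = (p - 2) + 1 by ring, Real.rpow_add_one ht.ne',
          ENNReal.ofReal_mul (by positivity), mul_assoc, mul_left_comm K]
        exact mul_le_mul_right (h t ht) _
    _ = ENNReal.ofReal p * K * ∫⁻ x, g x * (∫⁻ t in Ioi (0 : ℝ),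
          (if ENNReal.ofReal t < B * g x then ENNReal.ofReal (t ^ (p - 2)) else 0)) ∂μ := by
        have hm : Measurable (fun q : ℝ × X => g q.2 *
            (if ENNReal.ofReal q.1 < B * g q.2 then ENNReal.ofReal (q.1 ^ (p - 2)) else 0)) := by
          refine (hg.comp measurable_snd).mul
            (Measurable.ite (measurableSet_lt ?_ ?_) ?_ measurable_const) <;> fun_prop
        rw [lintegral_const_mul _ hm.lintegral_prod_right', lintegral_lintegral_swap hm.aemeasurable,
          mul_assoc]
        congr 3 with x
        dsimp only
        rw [lintegral_const_mul]
        refine Measurable.ite (measurableSet_lt ?_ ?_) ?_ measurable_const <;> fun_prop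
    _ ≤ ENNReal.ofReal p * K * ∫⁻ x, (B ^ (p - 1) / ENNReal.ofReal (p - 1)) * g x ^ p ∂μ := by
        refine mul_le_mul_right (lintegral_mono fun x => ?_) _
        have h1 := lintegral_Ioi_ite_rpow_le (r := p - 2) (by linarith) (B * g x)
        rw [show p - 2 + 1 = p - 1 by ring] at h1
        calc _ ≤ g x * ((B * g x) ^ (p - 1) / ENNReal.ofReal (p - 1)) := by gcongr
          _ = (B ^ (p - 1) / ENNReal.ofReal (p - 1)) * (g x ^ (1 : ℝ) * g x ^ (p - 1)) := by
            rw [ENNReal.mul_rpow_of_nonneg _ _ hp1.le, ENNReal.rpow_one, div_eq_mul_inv,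
              div_eq_mul_inv]
            ring
          _ = _ := by
            rw [← ENNReal.rpow_add_of_nonneg _ _ zero_le_one hp1.le]
            congr 2
            ring
    _ = _ := by
        rw [lintegral_const_mul _ (by fun_prop)]
        ring

end Interpolation

/-! ### Geometrically weighted sums of maximal functions -/

section WeightedMaximal

variable {X ι : Type*} [MeasurableSpace X] {μ : Measure X}

/-- The sum `∑ m, 4 ^ (-m) M_m g`, where `M_m` is the uncentred maximal function over the family
`R m`. -/
noncomputable def weightedMaximal (μ : Measure X) (R : ℕ → ι → Set X) (g : X → ℝ≥0∞) (x : X) :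
    ℝ≥0∞ :=
  ∑' m : ℕ, (4⁻¹ : ℝ≥0∞) ^ m * setMaximal μ (R m) g x

theorem weightedMaximal_mono_ae {R : ℕ → ι → Set X} {g h : X → ℝ≥0∞} (hgh : g ≤ᵐ[μ] h) (x : X) :
    weightedMaximal μ R g x ≤ weightedMaximal μ R h x :=
  ENNReal.tsum_le_tsum fun _ => mul_le_mul_right (setMaximal_mono_ae hgh x) _

theorem weightedMaximal_add_le {R : ℕ → ι → Set X} {g h : X → ℝ≥0∞} (hg : AEMeasurable g μ)
    (x : X) : weightedMaximal μ R (fun y => g y + h y) x ≤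
      weightedMaximal μ R g x + weightedMaximal μ R h x := by
  rw [weightedMaximal, weightedMaximal, weightedMaximal, ← ENNReal.tsum_add]
  refine ENNReal.tsum_le_tsum fun m => ?_
  rw [← mul_add]
  exact mul_le_mul_right (setMaximal_add_le hg x) _

theorem weightedMaximal_const_le {R : ℕ → ι → Set X} (c : ℝ≥0∞) (x : X) :
    weightedMaximal μ R (fun _ => c) x ≤ 2 * c := by
  calc weightedMaximal μ R (fun _ => c) x ≤ ∑' m : ℕ, (2⁻¹ : ℝ≥0∞) ^ m * c := by
        refine ENNReal.tsum_le_tsum fun m => ?_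
        gcongr
        · norm_num
        · exact setMaximal_const_le c x
    _ = 2 * c := by
        rw [ENNReal.tsum_mul_right, ENNReal.tsum_geometric, ENNReal.one_sub_inv_two, inv_inv]

/-- If `∑ m, 4 ^ (-m) M_m g` exceeds `γ` then some `M_m g` exceeds `2 ^ m γ / 2`, and the weak
type bounds at these heights are summable. -/
theorem mul_measure_lt_weightedMaximal_le {R : ℕ → ι → Set X} {g : X → ℝ≥0∞} {K : ℝ≥0∞}
    (hweak : ∀ m γ, γ * μ {x | γ < setMaximal μ (R m) g x} ≤ K) (γ : ℝ≥0∞) :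
    γ * μ {x | γ < weightedMaximal μ R g x} ≤ 4 * K := by
  have h24 : ∀ m : ℕ, (4⁻¹ : ℝ≥0∞) ^ m * (2 ^ m * (2⁻¹ * γ)) = 2⁻¹ ^ m * (2⁻¹ * γ) := by
    intro m
    rw [← mul_assoc, ← mul_pow, show (4 : ℝ≥0∞) = 2 * 2 by norm_num,
      ENNReal.mul_inv (by simp) (by simp), mul_assoc, ENNReal.inv_mul_cancel (by simp) (by simp),
      mul_one]
  have hsub : {x | γ < weightedMaximal μ R g x} ⊆
      ⋃ m : ℕ, {x | 2 ^ m * (2⁻¹ * γ) < setMaximal μ (R m) g x} := by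
    intro x hx
    by_contra hcon
    simp only [mem_iUnion, mem_ofPred_eq, not_exists, not_lt] at hcon
    rw [mem_ofPred_eq] at hx
    refine (not_le.2 hx) ?_
    calc weightedMaximal μ R g x ≤ ∑' m : ℕ, (4⁻¹ : ℝ≥0∞) ^ m * (2 ^ m * (2⁻¹ * γ)) :=
          ENNReal.tsum_le_tsum fun m => mul_le_mul_right (hcon m) _
      _ = γ := by
          simp_rw [h24]
          rw [ENNReal.tsum_mul_right, ENNReal.tsum_geometric, ENNReal.one_sub_inv_two, inv_inv,
            ← mul_assoc, ENNReal.mul_inv_cancel (by simp) (by simp), one_mul]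
  calc γ * μ {x | γ < weightedMaximal μ R g x}
      ≤ γ * ∑' m : ℕ, μ {x | 2 ^ m * (2⁻¹ * γ) < setMaximal μ (R m) g x} := by
        gcongr
        exact (measure_mono hsub).trans (measure_iUnion_le _)
    _ = ∑' m : ℕ, 2 * 2⁻¹ ^ m *
          (2 ^ m * (2⁻¹ * γ) * μ {x | 2 ^ m * (2⁻¹ * γ) < setMaximal μ (R m) g x}) := by
        rw [← ENNReal.tsum_mul_left]
        congr 1 with m
        generalize μ {x | 2 ^ m * (2⁻¹ * γ) < setMaximal μ (R m) g x} = a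
        calc γ * a = (2 * 2⁻¹) * (2⁻¹ * 2) ^ m * γ * a := by
              rw [ENNReal.inv_mul_cancel (by simp) (by simp),
                ENNReal.mul_inv_cancel (by simp) (by simp)]
              simp
          _ = _ := by rw [mul_pow]; ring
    _ ≤ ∑' m : ℕ, 2 * 2⁻¹ ^ m * K :=
        ENNReal.tsum_le_tsum fun m => mul_le_mul_right (hweak m _) _
    _ = 4 * K := by
        rw [ENNReal.tsum_mul_right, ENNReal.tsum_mul_left, ENNReal.tsum_geometric,
          ENNReal.one_sub_inv_two, inv_inv]
        norm_num

variable [TopologicalSpace X] [OpensMeasurableSpace X]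

theorem measurable_weightedMaximal {R : ℕ → ι → Set X} (hR : ∀ m i, IsOpen (R m i))
    (g : X → ℝ≥0∞) : Measurable (weightedMaximal μ R g) :=
  Measurable.tsum fun m => (measurable_setMaximal (hR m) g).const_mul _

/-- Strong type `(p, p)`, `1 < p < ∞`, from weak type `(1, 1)` uniformly in the family. -/
theorem lintegral_weightedMaximal_rpow_le [SFinite μ] {R : ℕ → ι → Set X}
    (hR : ∀ m i, IsOpen (R m i)) {D : ℝ≥0∞}
    (hweak : ∀ m (g : X → ℝ≥0∞) γ, γ * μ {x | γ < setMaximal μ (R m) g x} ≤ D * ∫⁻ y, g y ∂μ)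
    {p : ℝ} (hp : 1 < p) {g : X → ℝ≥0∞} (hg : AEMeasurable g μ) :
    ∫⁻ x, weightedMaximal μ R g x ^ p ∂μ ≤
      ENNReal.ofReal p * (8 * D) * (4 ^ (p - 1) / ENNReal.ofReal (p - 1)) * ∫⁻ x, g x ^ p ∂μ := by
  wlog hgm : Measurable g generalizing g
  · have hae := hg.ae_eq_mk
    have h := this hg.measurable_mk.aemeasurable hg.measurable_mk
    calc _ ≤ ∫⁻ x, weightedMaximal μ R (hg.mk g) x ^ p ∂μ := by
          gcongr with x
          exact weightedMaximal_mono_ae hae.le x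
      _ ≤ _ := h
      _ = _ := by
          congr 1
          refine lintegral_congr_ae ?_
          filter_upwards [hae] with x hx
          rw [hx]
  refine lintegral_rpow_le_of_measure_lt_le (measurable_weightedMaximal hR g) hgm hp ?_
  intro t ht
  set γ := ENNReal.ofReal t
  -- split `g` at height `γ / 4`; the bounded part contributes at most `γ / 2`
  set S := {x | γ < 4 * g x}
  have hS : MeasurableSet S := measurableSet_lt measurable_const (hgm.const_mul _)
  have hsplit : ∀ x, g x ≤ S.indicator g x + 4⁻¹ * γ := by
    intro x
    by_cases hx : x ∈ S
    · rw [indicator_of_mem hx]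
      exact le_self_add
    · rw [indicator_of_notMem hx, zero_add]
      have hx : 4 * g x ≤ γ := not_lt.1 hx
      rw [mul_comm, ← div_eq_mul_inv, ENNReal.le_div_iff_mul_le (by simp) (by simp), mul_comm]
      exact hx
  have h24 : (2 : ℝ≥0∞) * (4⁻¹ * γ) = 2⁻¹ * γ := by
    rw [← mul_assoc, show (4 : ℝ≥0∞) = 2 * 2 by norm_num,
      ENNReal.mul_inv (by simp) (by simp), ← mul_assoc, ENNReal.mul_inv_cancel (by simp) (by simp),
      one_mul]
  have hsub : {x | γ < weightedMaximal μ R g x} ⊆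
      {x | 2⁻¹ * γ < weightedMaximal μ R (S.indicator g) x} := by
    intro x hx
    have h1 : weightedMaximal μ R g x ≤
        weightedMaximal μ R (S.indicator g) x + 2⁻¹ * γ :=
      calc weightedMaximal μ R g x
          ≤ weightedMaximal μ R (fun y => S.indicator g y + 4⁻¹ * γ) x :=
            weightedMaximal_mono_ae (ae_of_all _ hsplit) x
        _ ≤ weightedMaximal μ R (S.indicator g) x + weightedMaximal μ R (fun _ => 4⁻¹ * γ) x :=
            weightedMaximal_add_le (hgm.indicator hS).aemeasurable x
        _ ≤ _ := by
            gcongr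
            rw [← h24]
            exact weightedMaximal_const_le _ x
    have h2 : 2⁻¹ * γ + 2⁻¹ * γ < weightedMaximal μ R (S.indicator g) x + 2⁻¹ * γ := by
      refine lt_of_lt_of_le ?_ h1
      rw [← add_mul, ENNReal.inv_two_add_inv_two, one_mul]
      exact hx
    exact lt_of_add_lt_add_right h2
  have hw := mul_measure_lt_weightedMaximal_le
    (fun m γ' => hweak m (S.indicator g) γ') (2⁻¹ * γ)
  calc γ * μ {x | γ < weightedMaximal μ R g x}
      = 2 * (2⁻¹ * γ * μ {x | γ < weightedMaximal μ R g x}) := by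
        rw [← mul_assoc, ← mul_assoc, ENNReal.mul_inv_cancel (by simp) (by simp), one_mul]
    _ ≤ 2 * (2⁻¹ * γ * μ {x | 2⁻¹ * γ < weightedMaximal μ R (S.indicator g) x}) := by
        gcongr
    _ ≤ 2 * (4 * (D * ∫⁻ y, S.indicator g y ∂μ)) := by gcongr
    _ = _ := by
        rw [lintegral_indicator hS]
        ring

end WeightedMaximal

/-! ### Rectangles in the orthant -/

instance sigmaFinite_besselMeasureLine (l : ℝ) : SigmaFinite (besselMeasureLine l) := by
  unfold besselMeasureLine
  exact SigmaFinite.withDensity_of_ne_top (ae_of_all _ fun _ => ENNReal.ofReal_ne_top)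

theorem besselMeasure_eq_pi {n : ℕ} (lam : Fin n → ℝ) :
    besselMeasure lam = Measure.pi fun j => besselMeasureLine (lam j) := rfl

instance sigmaFinite_besselMeasure {n : ℕ} (lam : Fin n → ℝ) :
    SigmaFinite (besselMeasure lam) := by
  rw [besselMeasure_eq_pi]
  infer_instance

/-- The open orthant `(0, ∞)^n`. -/
def orthant (n : ℕ) : Set (Fin n → ℝ) := univ.pi fun _ => Ioi 0

theorem mem_orthant {n : ℕ} {x : Fin n → ℝ} : x ∈ orthant n ↔ ∀ j, 0 < x j := by
  simp [orthant]

theorem measurableSet_orthant (n : ℕ) : MeasurableSet (orthant n) :=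
  MeasurableSet.univ_pi fun _ => measurableSet_Ioi

theorem ae_mem_orthant {n : ℕ} (lam : Fin n → ℝ) : ∀ᵐ x ∂besselMeasure lam, x ∈ orthant n := by
  simp only [mem_orthant]
  rw [ae_all_iff]
  intro j
  have h1 : ∀ᵐ u ∂besselMeasureLine (lam j), 0 < u := by
    have h2 : ∀ᵐ u ∂(volume.restrict (Ioi (0 : ℝ))), 0 < u := ae_restrict_mem measurableSet_Ioi
    exact (withDensity_absolutelyContinuous _ _).ae_le h2
  exact (Measure.tendsto_eval_ae_ae (μ := fun j => besselMeasureLine (lam j))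
    (i := j)).eventually h1

/-- The open rectangle with centre `c` and half sides `ρ j`. -/
def rect {n : ℕ} (c ρ : Fin n → ℝ) : Set (Fin n → ℝ) :=
  univ.pi fun j => Metric.ball (c j) (ρ j)

section Rect

variable {n : ℕ} {lam c c' ρ ρ' : Fin n → ℝ}

theorem mem_rect {x : Fin n → ℝ} : x ∈ rect c ρ ↔ ∀ j, |x j - c j| < ρ j := by
  simp [rect, Real.dist_eq]

theorem isOpen_rect : IsOpen (rect c ρ) :=
  isOpen_set_pi finite_univ fun _ _ => Metric.isOpen_ball

theorem self_mem_rect (hρ : ∀ j, 0 < ρ j) : c ∈ rect c ρ :=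
  mem_rect.2 fun j => by simpa using hρ j

theorem rect_subset_rect (h : ∀ j, ρ j ≤ ρ' j) : rect c ρ ⊆ rect c ρ' :=
  pi_mono fun j _ => Metric.ball_subset_ball (h j)

theorem rect_subset_of_inter_nonempty (h : (rect c ρ ∩ rect c' ρ').Nonempty)
    (hρ : ∀ j, ρ j ≤ ρ' j) : rect c ρ ⊆ rect c' (fun j => 3 * ρ' j) := by
  obtain ⟨z, hz, hz'⟩ := h
  intro x hx
  rw [mem_rect] at *
  intro j
  have h1 := abs_lt.1 (hx j)
  have h2 := abs_lt.1 (hz j)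
  have h3 := abs_lt.1 (hz' j)
  have h4 := hρ j
  rw [abs_lt]
  constructor <;> linarith

theorem besselMeasure_rect :
    besselMeasure lam (rect c ρ) = ∏ j, besselMeasureLine (lam j) (Metric.ball (c j) (ρ j)) := by
  rw [besselMeasure_eq_pi, rect, Measure.pi_pi]

theorem besselMeasure_rect_ne_zero (hc : ∀ j, 0 < c j) (hρ : ∀ j, 0 < ρ j) :
    besselMeasure lam (rect c ρ) ≠ 0 := by
  rw [besselMeasure_rect]
  exact Finset.prod_ne_zero_iff.2 fun j _ => (besselMeasureLine_ball_pos (hc j) (hρ j)).ne'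

theorem besselMeasure_rect_ne_top (hlam : ∀ j, -(1 / 2 : ℝ) < lam j) (hc : ∀ j, 0 < c j)
    (hρ : ∀ j, 0 < ρ j) : besselMeasure lam (rect c ρ) ≠ ∞ := by
  rw [besselMeasure_rect]
  exact ENNReal.prod_ne_top fun j _ => (besselMeasureLine_ball_lt_top (hlam j) (hc j) (hρ j)).ne

theorem exists_besselMeasure_rect_mul_le (hlam : ∀ j, -(1 / 2 : ℝ) < lam j) :
    ∃ (D : ℝ) (M : ℕ), 0 < D ∧ ∀ (c ρ : Fin n → ℝ) (κ : ℝ), (∀ j, 0 < c j) → (∀ j, 0 < ρ j) →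
      1 ≤ κ → besselMeasure lam (rect c fun j => κ * ρ j) ≤
        ENNReal.ofReal (D * κ ^ M) * besselMeasure lam (rect c ρ) := by
  choose D M hD h using fun j => exists_besselMeasureLine_ball_mul_le (hlam j)
  refine ⟨∏ j, D j, ∑ j, M j, Finset.prod_pos fun j _ => hD j, fun c ρ κ hc hρ hκ => ?_⟩
  rw [besselMeasure_rect, besselMeasure_rect, ← Finset.prod_pow_eq_pow_sum,
    ← Finset.prod_mul_distrib, ENNReal.ofReal_prod_of_nonneg, ← Finset.prod_mul_distrib]
  · exact Finset.prod_le_prod' fun j _ => h j _ _ _ (hc j) (hρ j) hκ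
  · intro j _
    have := hD j
    positivity

end Rect

/-! ### Bounds of the product kernel -/

section Kernel

variable {n : ℕ} {lam : Fin n → ℝ}

theorem besselHeatKernelPi_nonneg (hlam : ∀ j, -(1 / 2 : ℝ) < lam j) {s x y : Fin n → ℝ}
    (hs : ∀ j, 0 < s j) (hx : ∀ j, 0 < x j) (hy : ∀ j, 0 < y j) :
    0 ≤ besselHeatKernelPi lam s x y :=
  Finset.prod_nonneg fun j _ => besselHeatKernel_nonneg (hlam j) (hs j) (hx j) (hy j)

theorem continuousOn_besselHeatKernelPi (hlam : ∀ j, -(1 / 2 : ℝ) < lam j) :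
    ContinuousOn (fun q : (Fin n → ℝ) × (Fin n → ℝ) × (Fin n → ℝ) =>
      besselHeatKernelPi lam q.1 q.2.1 q.2.2) (orthant n ×ˢ orthant n ×ˢ orthant n) := by
  refine continuousOn_finsetProd _ fun j _ => ?_
  refine (continuousOn_besselHeatKernel (hlam j)).comp
    (f := fun q : (Fin n → ℝ) × (Fin n → ℝ) × (Fin n → ℝ) => (q.1 j, q.2.1 j, q.2.2 j))
    (Continuous.continuousOn (by fun_prop)) ?_
  intro q hq
  exact ⟨mem_orthant.1 hq.1 j, mem_orthant.1 hq.2.1 j, mem_orthant.1 hq.2.2 j⟩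

theorem exists_besselHeatKernelPi_mul_rect_le (hlam : ∀ j, -(1 / 2 : ℝ) < lam j) :
    ∃ (A : ℝ) (M : ℕ), 0 < A ∧ ∀ (s x y : Fin n → ℝ) (κ : ℝ), (∀ j, 0 < s j) → (∀ j, 0 < x j) →
      (∀ j, 0 < y j) → 1 ≤ κ → y ∈ rect x (fun j => κ * √(s j)) →
      ENNReal.ofReal (besselHeatKernelPi lam s x y) *
          besselMeasure lam (rect x fun j => κ * √(s j)) ≤
        ENNReal.ofReal (A * κ ^ M * Real.exp (-∑ j, (x j - y j) ^ 2 / (4 * s j))) := by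
  choose A M hA h using fun j => exists_besselHeatKernel_mul_ball_le (hlam j)
  refine ⟨∏ j, A j, ∑ j, M j, Finset.prod_pos fun j _ => hA j,
    fun s x y κ hs hx hy hκ hxy => ?_⟩
  rw [mem_rect] at hxy
  rw [besselMeasure_rect, besselHeatKernelPi, ENNReal.ofReal_prod_of_nonneg,
    ← Finset.prod_mul_distrib, ← Finset.sum_neg_distrib, Real.exp_sum,
    ← Finset.prod_pow_eq_pow_sum, ← Finset.prod_mul_distrib, ← Finset.prod_mul_distrib,
    ENNReal.ofReal_prod_of_nonneg]
  · refine Finset.prod_le_prod' fun j _ => ?_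
    rw [← neg_div]
    exact h j _ _ _ _ (hs j) (hx j) (hy j) hκ (by rw [abs_sub_comm]; exact hxy j)
  · intro j _
    have := hA j
    positivity
  · exact fun j _ => besselHeatKernel_nonneg (hlam j) (hs j) (hx j) (hy j)

theorem pow_mul_exp_neg_sq_le (N : ℕ) {κ : ℝ} (hκ : 1 ≤ κ) :
    κ ^ N * Real.exp (-(κ ^ 2 / 16)) ≤ 16 ^ N * N ! := by
  have h1 := Real.pow_div_factorial_le_exp (κ ^ 2 / 16) (by positivity) N
  rw [Real.exp_neg, ← div_eq_mul_inv, div_le_iff₀ (Real.exp_pos _)]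
  calc κ ^ N ≤ (κ ^ 2) ^ N := by
        gcongr
        nlinarith
    _ = 16 ^ N * N ! * ((κ ^ 2 / 16) ^ N / N !) := by
        have : (N ! : ℝ) ≠ 0 := by positivity
        rw [div_pow]
        field_simp
    _ ≤ _ := by gcongr

/-- The least dyadic dilate of the rectangle with half sides `√(s j)` that contains `y` controls
the kernel: by minimality some coordinate satisfies `|x j - y j| ≥ 2 ^ (m - 1) √(s j)`, and the
resulting factor `exp (-4 ^ m / 16)` beats every power of `2 ^ m`. One common dilation for all
coordinates suffices, so that one-parameter families of rectangles arise. -/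
theorem exists_besselHeatKernelPi_le (hlam : ∀ j, -(1 / 2 : ℝ) < lam j) :
    ∃ A : ℝ≥0, ∀ s x y : Fin n → ℝ, (∀ j, 0 < s j) → (∀ j, 0 < x j) → (∀ j, 0 < y j) →
      ∃ m : ℕ, y ∈ rect x (fun j => 2 ^ m * √(s j)) ∧
        ENNReal.ofReal (besselHeatKernelPi lam s x y) ≤
          A * (4⁻¹ ^ m * (besselMeasure lam (rect x fun j => 2 ^ m * √(s j)))⁻¹) := by
  obtain ⟨A, M, hA, h⟩ := exists_besselHeatKernelPi_mul_rect_le hlam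
  refine ⟨(A * (Real.exp (1 / 16) * (16 ^ (M + 2) * (M + 2)!))).toNNReal,
    fun s x y hs hx hy => ?_⟩
  have hρ : ∀ j, 0 < √(s j) := fun j => Real.sqrt_pos.2 (hs j)
  have hex : ∃ m : ℕ, y ∈ rect x (fun j => 2 ^ m * √(s j)) := by
    have hev : ∀ j, ∀ᶠ m : ℕ in atTop, |y j - x j| < 2 ^ m * √(s j) := fun j =>
      ((tendsto_pow_atTop_atTop_of_one_lt (one_lt_two (α := ℝ))).atTop_mul_const
        (hρ j)).eventually_gt_atTop _
    obtain ⟨m, hm⟩ := (eventually_all.2 hev).exists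
    exact ⟨m, mem_rect.2 hm⟩
  classical
  refine ⟨Nat.find hex, Nat.find_spec hex, ?_⟩
  have hmin := fun k => Nat.find_min hex (m := k)
  have hmem := Nat.find_spec hex
  generalize Nat.find hex = m at *
  have hκ : (1 : ℝ) ≤ 2 ^ m := one_le_pow₀ one_le_two
  -- the factor `exp (1 / 16)` covers `m = 0`, where minimality says nothing
  have hE : Real.exp (-∑ j, (x j - y j) ^ 2 / (4 * s j)) ≤
      Real.exp (1 / 16) * Real.exp (-((2 ^ m) ^ 2 / 16)) := by
    rw [← Real.exp_add]
    refine Real.exp_le_exp.2 ?_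
    have hnn : ∀ j ∈ Finset.univ, 0 ≤ (x j - y j) ^ 2 / (4 * s j) := fun j _ => by
      have := hs j
      positivity
    cases m with
    | zero =>
      have := Finset.sum_nonneg hnn
      norm_num
      exact this
    | succ k =>
      have hk := hmin k (Nat.lt_succ_self k)
      rw [mem_rect] at hk
      push Not at hk
      obtain ⟨j, hj⟩ := hk
      have hsj := hs j
      have h1 : (2 ^ (k + 1)) ^ 2 / 16 ≤ (x j - y j) ^ 2 / (4 * s j) := by
        rw [le_div_iff₀ (by positivity)]
        calc ((2 : ℝ) ^ (k + 1)) ^ 2 / 16 * (4 * s j) = (2 ^ k * √(s j)) ^ 2 := by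
              rw [mul_pow, Real.sq_sqrt hsj.le, pow_succ]; ring
          _ ≤ |y j - x j| ^ 2 := by gcongr
          _ = (x j - y j) ^ 2 := by rw [sq_abs]; ring
      have h2 := Finset.single_le_sum hnn (Finset.mem_univ j)
      linarith
  have hb := h s x y _ hs hx hy hκ hmem
  set μR := besselMeasure lam (rect x fun j => 2 ^ m * √(s j)) with hμR
  have h0 : μR ≠ 0 := besselMeasure_rect_ne_zero hx fun j => by have := hρ j; positivity
  have ht : μR ≠ ∞ := besselMeasure_rect_ne_top hlam hx fun j => by have := hρ j; positivity
  rw [← mul_assoc, ← div_eq_mul_inv, ENNReal.le_div_iff_mul_le (Or.inl h0) (Or.inl ht)]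
  refine hb.trans ?_
  have e4 : (4⁻¹ : ℝ≥0∞) ^ m = ENNReal.ofReal (((2 ^ m) ^ 2)⁻¹) := by
    rw [← pow_mul, mul_comm, pow_mul, ← inv_pow, ENNReal.ofReal_pow (by norm_num),
      ENNReal.ofReal_inv_of_pos (by norm_num)]
    norm_num
  rw [e4, ← ENNReal.ofReal_coe_nnreal, ← ENNReal.ofReal_mul (by positivity)]
  refine ENNReal.ofReal_le_ofReal ?_
  rw [Real.coe_toNNReal _ (by positivity), ← div_eq_mul_inv, le_div_iff₀ (by positivity)]
  calc A * (2 ^ m) ^ M * Real.exp (-∑ j, (x j - y j) ^ 2 / (4 * s j)) * (2 ^ m) ^ 2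
      ≤ A * (2 ^ m) ^ M * (Real.exp (1 / 16) * Real.exp (-((2 ^ m) ^ 2 / 16))) * (2 ^ m) ^ 2 := by
        gcongr
    _ = A * (Real.exp (1 / 16) * ((2 ^ m) ^ (M + 2) * Real.exp (-((2 ^ m) ^ 2 / 16)))) := by ring
    _ ≤ _ := by
        have := pow_mul_exp_neg_sq_le (M + 2) hκ
        exact mul_le_mul_of_nonneg_left (mul_le_mul_of_nonneg_left this (by positivity)) hA.le

/-- A majorant, up to a constant factor, of the kernels `besselHeatKernelPi lam s x y` for all
`s₀ ≤ s ≤ s₁` at once. For `s₀ = s₁ = s` its integral against `g` is a weighted sum of averages of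
`g` over the dyadic dilates of the rectangle with centre `x` and half sides `√(s j)`. -/
noncomputable def besselMajorant (lam s₀ s₁ x y : Fin n → ℝ) : ℝ≥0∞ :=
  ∑' m : ℕ, 4⁻¹ ^ m * (rect x fun j => 2 ^ m * √(s₁ j)).indicator
    (fun _ => (besselMeasure lam (rect x fun j => 2 ^ m * √(s₀ j)))⁻¹) y

theorem measurable_besselMajorant (s₀ s₁ x : Fin n → ℝ) :
    Measurable (besselMajorant lam s₀ s₁ x) :=
  Measurable.tsum fun _ => (measurable_const.indicator isOpen_rect.measurableSet).const_mul _

theorem exists_besselHeatKernelPi_le_majorant (hlam : ∀ j, -(1 / 2 : ℝ) < lam j) :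
    ∃ A : ℝ≥0, ∀ s₀ s s₁ x y : Fin n → ℝ, (∀ j, 0 < s j) → s₀ ≤ s → s ≤ s₁ → (∀ j, 0 < x j) →
      (∀ j, 0 < y j) →
      ENNReal.ofReal (besselHeatKernelPi lam s x y) ≤ A * besselMajorant lam s₀ s₁ x y := by
  obtain ⟨A, h⟩ := exists_besselHeatKernelPi_le hlam
  refine ⟨A, fun s₀ s s₁ x y hs hs₀ hs₁ hx hy => ?_⟩
  obtain ⟨m, hm, hK⟩ := h s x y hs hx hy
  refine hK.trans (mul_le_mul_right ?_ _)
  refine le_trans ?_ (ENNReal.le_tsum m)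
  gcongr
  have hm' : y ∈ rect x fun j => 2 ^ m * √(s₁ j) :=
    rect_subset_rect (fun j => by have := hs₁ j; gcongr) hm
  rw [indicator_of_mem hm']
  gcongr
  exact rect_subset_rect fun j => by have := hs₀ j; gcongr

theorem lintegral_besselMajorant_mul {s₀ s₁ x : Fin n → ℝ} {g : (Fin n → ℝ) → ℝ≥0∞}
    (hg : AEMeasurable g (besselMeasure lam)) :
    ∫⁻ y, besselMajorant lam s₀ s₁ x y * g y ∂besselMeasure lam =
      ∑' m : ℕ, 4⁻¹ ^ m * ((∫⁻ y in rect x fun j => 2 ^ m * √(s₁ j), g y ∂besselMeasure lam) /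
        besselMeasure lam (rect x fun j => 2 ^ m * √(s₀ j))) := by
  simp only [besselMajorant, ← ENNReal.tsum_mul_right]
  rw [lintegral_tsum]
  · congr 1 with m
    simp only [mul_assoc]
    rw [lintegral_const_mul' _ _ (by simp), div_eq_mul_inv, mul_comm (lintegral _ _),
      ← lintegral_const_mul'' _ hg.restrict, ← lintegral_indicator isOpen_rect.measurableSet]
    congr 2 with y
    by_cases hy : y ∈ rect x fun j => 2 ^ m * √(s₁ j) <;> simp [hy]
  · intro m
    exact ((measurable_const.indicator isOpen_rect.measurableSet).const_mul _).aemeasurable.mul hg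

/-- By Hölder's inequality, the average over a rectangle `E` is at most `‖f‖_p (1 + μ E) / μ E`,
and doubling compares the rectangles belonging to `s₁` with those of `s₀`. -/
theorem lintegral_besselMajorant_mul_lt_top {𝕜 : Type*} [RCLike 𝕜]
    (hlam : ∀ j, -(1 / 2 : ℝ) < lam j) {s₀ s₁ x : Fin n → ℝ} (hs₀ : ∀ j, 0 < s₀ j)
    (hx : ∀ j, 0 < x j) {p : ℝ≥0∞} (hp : 1 ≤ p) {f : (Fin n → ℝ) → 𝕜}
    (hf : MemLp f p (besselMeasure lam)) :
    ∫⁻ y, besselMajorant lam s₀ s₁ x y * ‖f y‖ₑ ∂besselMeasure lam < ∞ := by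
  obtain ⟨D, M, hD, hdoub⟩ := exists_besselMeasure_rect_mul_le hlam
  set μ := besselMeasure lam
  have hρ₀ : ∀ j, 0 < √(s₀ j) := fun j => Real.sqrt_pos.2 (hs₀ j)
  set κ : ℝ := 1 + ∑ j, √(s₁ j) / √(s₀ j) with hκ
  have hκ1 : 1 ≤ κ := by
    have : 0 ≤ ∑ j, √(s₁ j) / √(s₀ j) := Finset.sum_nonneg fun j _ => by positivity
    linarith
  have hκs : ∀ j, √(s₁ j) ≤ κ * √(s₀ j) := by
    intro j
    rw [← div_le_iff₀ (hρ₀ j)]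
    have := Finset.single_le_sum (f := fun j => √(s₁ j) / √(s₀ j)) (fun j _ => by positivity)
      (Finset.mem_univ j)
    linarith
  set D' : ℝ≥0∞ := ENNReal.ofReal (D * κ ^ M)
  set V := μ (rect x fun j => √(s₀ j))
  have hV : V ≠ 0 := besselMeasure_rect_ne_zero hx hρ₀
  rw [lintegral_besselMajorant_mul hf.1.enorm]
  have hterm : ∀ m : ℕ, (∫⁻ y in rect x fun j => 2 ^ m * √(s₁ j), ‖f y‖ₑ ∂μ) /
      μ (rect x fun j => 2 ^ m * √(s₀ j)) ≤ eLpNorm f p μ * (V⁻¹ + D') := by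
    intro m
    set E₁ := rect x fun j => 2 ^ m * √(s₁ j) with hE₁
    set E₀ := rect x fun j => 2 ^ m * √(s₀ j) with hE₀
    have hE₀0 : μ E₀ ≠ 0 := besselMeasure_rect_ne_zero hx fun j => by have := hρ₀ j; positivity
    have hE₀t : μ E₀ ≠ ∞ :=
      besselMeasure_rect_ne_top hlam hx fun j => by have := hρ₀ j; positivity
    have hVE : V ≤ μ E₀ := measure_mono (rect_subset_rect fun j =>
      le_mul_of_one_le_left (Real.sqrt_nonneg _) (one_le_pow₀ one_le_two))
    have hEE : μ E₁ ≤ D' * μ E₀ := by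
      refine le_trans (measure_mono (rect_subset_rect fun j => ?_))
        (hdoub x (fun j => 2 ^ m * √(s₀ j)) κ hx
          (fun j => by have := hρ₀ j; positivity) hκ1)
      have := hκs j
      calc 2 ^ m * √(s₁ j) ≤ 2 ^ m * (κ * √(s₀ j)) := by gcongr
        _ = _ := by ring
    have hHolder : ∫⁻ y in E₁, ‖f y‖ₑ ∂μ ≤ eLpNorm f p μ * (1 + μ E₁) := by
      rw [← eLpNorm_one_eq_lintegral_enorm]
      refine (eLpNorm_le_eLpNorm_mul_rpow_measure_univ hp hf.1.restrict).trans ?_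
      rw [Measure.restrict_apply_univ]
      refine mul_le_mul' (eLpNorm_mono_measure _ Measure.restrict_le_self) ?_
      have hθ0 : 0 ≤ 1 / (1 : ℝ≥0∞).toReal - 1 / p.toReal := by
        rcases eq_or_ne p ∞ with rfl | hpt
        · simp
        · have : 1 ≤ p.toReal := by
            rw [← ENNReal.toReal_one]
            exact ENNReal.toReal_mono hpt hp
          rw [ENNReal.toReal_one, sub_nonneg]
          exact one_div_le_one_div_of_le one_pos this
      have hθ1 : 1 / (1 : ℝ≥0∞).toReal - 1 / p.toReal ≤ 1 := by
        have : 0 ≤ 1 / p.toReal := by positivity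
        rw [ENNReal.toReal_one]
        linarith
      rcases le_total (μ E₁) 1 with h1 | h1
      · exact (ENNReal.rpow_le_one h1 hθ0).trans le_self_add
      · calc μ E₁ ^ (1 / (1 : ℝ≥0∞).toReal - 1 / p.toReal) ≤ μ E₁ ^ (1 : ℝ) :=
              ENNReal.rpow_le_rpow_of_exponent_le h1 hθ1
          _ ≤ 1 + μ E₁ := by rw [ENNReal.rpow_one]; exact le_add_self
    rw [ENNReal.div_le_iff hE₀0 hE₀t]
    refine hHolder.trans ?_
    rw [mul_assoc, add_mul]
    refine mul_le_mul_right (add_le_add ?_ hEE) _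
    rw [← ENNReal.div_eq_inv_mul, ENNReal.le_div_iff_mul_le (Or.inl hV)
      (Or.inl (ne_top_of_le_ne_top hE₀t hVE)), one_mul]
    exact hVE
  calc _ ≤ ∑' m : ℕ, (2⁻¹ : ℝ≥0∞) ^ m * (eLpNorm f p μ * (V⁻¹ + D')) := by
        refine ENNReal.tsum_le_tsum fun m => ?_
        gcongr
        · norm_num
        · exact hterm m
    _ < ∞ := by
        rw [ENNReal.tsum_mul_right, ENNReal.tsum_geometric, ENNReal.one_sub_inv_two, inv_inv]
        refine ENNReal.mul_lt_top (by simp) (ENNReal.mul_lt_top hf.2 ?_)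
        exact ENNReal.add_lt_top.2 ⟨by simpa [pos_iff_ne_zero] using hV, ENNReal.ofReal_lt_top⟩

end Kernel

/-! ### Absolute convergence, continuity and measurability of the operators -/

section Operator

variable {𝕜 : Type*} [RCLike 𝕜] {n : ℕ} {lam : Fin n → ℝ}

theorem aestronglyMeasurable_besselHeatKernelPi_smul (hlam : ∀ j, -(1 / 2 : ℝ) < lam j)
    {s x : Fin n → ℝ} (hs : ∀ j, 0 < s j) (hx : ∀ j, 0 < x j) {f : (Fin n → ℝ) → 𝕜}
    (hf : AEStronglyMeasurable f (besselMeasure lam)) :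
    AEStronglyMeasurable (fun y => besselHeatKernelPi lam s x y • f y) (besselMeasure lam) := by
  refine AEStronglyMeasurable.smul ?_ hf
  have hc : ContinuousOn (fun y => besselHeatKernelPi lam s x y) (orthant n) :=
    (continuousOn_besselHeatKernelPi hlam).comp (f := fun y => (s, x, y))
      (Continuous.continuousOn (by fun_prop))
      fun y hy => ⟨mem_orthant.2 hs, mem_orthant.2 hx, hy⟩
  rw [← Measure.restrict_eq_self_of_ae_mem (ae_mem_orthant lam)]
  exact hc.aestronglyMeasurable (measurableSet_orthant n)

theorem exists_enorm_kernel_smul_le (hlam : ∀ j, -(1 / 2 : ℝ) < lam j) :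
    ∃ A : ℝ≥0, ∀ (f : (Fin n → ℝ) → 𝕜) (s₀ s s₁ x : Fin n → ℝ), (∀ j, 0 < s j) → s₀ ≤ s →
      s ≤ s₁ → (∀ j, 0 < x j) → ∀ᵐ y ∂besselMeasure lam,
        ‖besselHeatKernelPi lam s x y • f y‖ₑ ≤ A * (besselMajorant lam s₀ s₁ x y * ‖f y‖ₑ) := by
  obtain ⟨A, h⟩ := exists_besselHeatKernelPi_le_majorant hlam
  refine ⟨A, fun f s₀ s s₁ x hs hs₀ hs₁ hx => ?_⟩
  filter_upwards [ae_mem_orthant lam] with y hy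
  have hy := mem_orthant.1 hy
  rw [enorm_smul, Real.enorm_of_nonneg (besselHeatKernelPi_nonneg hlam hs hx hy), ← mul_assoc]
  gcongr
  exact h s₀ s s₁ x y hs hs₀ hs₁ hx hy

theorem integrable_besselHeatKernelPi_smul (hlam : ∀ j, -(1 / 2 : ℝ) < lam j)
    {s x : Fin n → ℝ} (hs : ∀ j, 0 < s j) (hx : ∀ j, 0 < x j) {p : ℝ≥0∞} (hp : 1 ≤ p)
    {f : (Fin n → ℝ) → 𝕜} (hf : MemLp f p (besselMeasure lam)) :
    Integrable (fun y => besselHeatKernelPi lam s x y • f y) (besselMeasure lam) := by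
  refine ⟨aestronglyMeasurable_besselHeatKernelPi_smul hlam hs hx hf.1, ?_⟩
  obtain ⟨A, h⟩ := exists_enorm_kernel_smul_le (𝕜 := 𝕜) hlam
  refine (lintegral_mono_ae (h f s s s x hs le_rfl le_rfl hx)).trans_lt ?_
  rw [lintegral_const_mul' _ _ ENNReal.coe_ne_top]
  exact ENNReal.mul_lt_top ENNReal.coe_lt_top
    (lintegral_besselMajorant_mul_lt_top hlam hs hx hp hf)

/-- Continuity in the time vector, by dominated convergence with the majorant for `s / 2` and
`2 s`. -/
theorem continuousAt_besselHeat (hlam : ∀ j, -(1 / 2 : ℝ) < lam j)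
    {s x : Fin n → ℝ} (hs : ∀ j, 0 < s j) (hx : ∀ j, 0 < x j) {p : ℝ≥0∞} (hp : 1 ≤ p)
    {f : (Fin n → ℝ) → 𝕜} (hf : MemLp f p (besselMeasure lam)) :
    ContinuousAt (fun s' => besselHeat lam s' f x) s := by
  obtain ⟨A, h⟩ := exists_enorm_kernel_smul_le (𝕜 := 𝕜) hlam
  set s₀ : Fin n → ℝ := fun j => s j / 2
  set s₁ : Fin n → ℝ := fun j => 2 * s j
  have hs₀ : ∀ j, 0 < s₀ j := fun j => half_pos (hs j)
  have hnear : ∀ᶠ s' in 𝓝 s, s₀ ≤ s' ∧ s' ≤ s₁ := by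
    have h1 : ∀ j, ∀ᶠ s' : Fin n → ℝ in 𝓝 s, s₀ j ≤ s' j ∧ s' j ≤ s₁ j := by
      intro j
      have hsj := hs j
      have hj : Tendsto (fun s' : Fin n → ℝ => s' j) (𝓝 s) (𝓝 (s j)) :=
        (continuous_apply j).continuousAt
      exact hj.eventually (Icc_mem_nhds (half_lt_self hsj) (lt_two_mul_self hsj))
    filter_upwards [eventually_all.2 h1] with s' hs'
    exact ⟨fun j => (hs' j).1, fun j => (hs' j).2⟩
  have hfin : ∫⁻ y, A * (besselMajorant lam s₀ s₁ x y * ‖f y‖ₑ) ∂besselMeasure lam ≠ ∞ := by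
    rw [lintegral_const_mul' _ _ ENNReal.coe_ne_top]
    exact (ENNReal.mul_lt_top ENNReal.coe_lt_top
      (lintegral_besselMajorant_mul_lt_top hlam hs₀ hx hp hf)).ne
  have hmeas : AEMeasurable (fun y => A * (besselMajorant lam s₀ s₁ x y * ‖f y‖ₑ))
      (besselMeasure lam) :=
    ((measurable_besselMajorant s₀ s₁ x).aemeasurable.mul hf.1.enorm).const_mul _
  refine tendsto_integral_filter_of_dominated_convergence
    (fun y => (A * (besselMajorant lam s₀ s₁ x y * ‖f y‖ₑ)).toReal) ?_ ?_
    (integrable_toReal_of_lintegral_ne_top hmeas hfin) ?_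
  · filter_upwards [hnear] with s' hs'
    exact aestronglyMeasurable_besselHeatKernelPi_smul hlam
      (fun j => (hs₀ j).trans_le (hs'.1 j)) hx hf.1
  · filter_upwards [hnear] with s' hs'
    filter_upwards [h f s₀ s' s₁ x (fun j => (hs₀ j).trans_le (hs'.1 j)) hs'.1 hs'.2 hx,
      ae_lt_top' hmeas hfin] with y hy hy'
    rw [← toReal_enorm]
    exact ENNReal.toReal_mono hy'.ne hy
  · filter_upwards [ae_mem_orthant lam] with y hy
    have hc : ContinuousOn (fun s' => besselHeatKernelPi lam s' x y) (orthant n) :=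
      (continuousOn_besselHeatKernelPi hlam).comp (f := fun s' => (s', x, y))
        (Continuous.continuousOn (by fun_prop)) fun s' hs' => ⟨hs', mem_orthant.2 hx, hy⟩
    have ho : orthant n ∈ 𝓝 s :=
      (isOpen_set_pi finite_univ fun _ _ => isOpen_Ioi).mem_nhds (mem_orthant.2 hs)
    exact (hc.continuousAt ho).tendsto.smul_const _

theorem aestronglyMeasurable_besselHeat (hlam : ∀ j, -(1 / 2 : ℝ) < lam j)
    {s : Fin n → ℝ} (hs : ∀ j, 0 < s j) {f : (Fin n → ℝ) → 𝕜}
    (hf : AEStronglyMeasurable f (besselMeasure lam)) :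
    AEStronglyMeasurable (besselHeat lam s f) (besselMeasure lam) := by
  have hK : AEStronglyMeasurable (fun q : (Fin n → ℝ) × (Fin n → ℝ) =>
      besselHeatKernelPi lam s q.1 q.2) ((besselMeasure lam).prod (besselMeasure lam)) := by
    have hc : ContinuousOn (fun q : (Fin n → ℝ) × (Fin n → ℝ) =>
        besselHeatKernelPi lam s q.1 q.2) (orthant n ×ˢ orthant n) :=
      (continuousOn_besselHeatKernelPi hlam).comp
        (f := fun q : (Fin n → ℝ) × (Fin n → ℝ) => (s, q.1, q.2))
        (Continuous.continuousOn (by fun_prop)) fun q hq => ⟨mem_orthant.2 hs, hq.1, hq.2⟩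
    rw [← Measure.restrict_eq_self_of_ae_mem (ae_mem_orthant lam), Measure.prod_restrict]
    exact hc.aestronglyMeasurable ((measurableSet_orthant n).prod (measurableSet_orthant n))
  exact (hK.smul hf.comp_snd).integral_prod_right'

end Operator

/-! ### The maximal operator -/

section Maximal

variable {𝕜 : Type*} [RCLike 𝕜] {n : ℕ} {lam : Fin n → ℝ} {r : Fin n → ℝ → ℝ}

/-- Continuity reduces the supremum over `t > 0` to a countable one, which preserves
measurability. -/
theorem iSup_enorm_eq_iSup_rat {E : Type*} [NormedAddCommGroup E] {F : ℝ → E}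
    (hF : ContinuousOn F (Ioi 0)) :
    ⨆ t : ℝ, ⨆ _ : 0 < t, ‖F t‖ₑ = ⨆ q : {q : ℚ // 0 < q}, ‖F (q : ℚ)‖ₑ := by
  refine le_antisymm (iSup₂_le fun t ht => ?_) (iSup_le fun q => ?_)
  · have hc : ContinuousAt (fun t => ‖F t‖ₑ) t := (hF.continuousAt (Ioi_mem_nhds ht)).enorm
    by_contra! hlt
    have hnear := (hc.eventually (lt_mem_nhds hlt)).and (Ioi_mem_nhds ht)
    obtain ⟨q, hq1, hq2⟩ := (Rat.denseRange_cast (𝕜 := ℝ)).exists_mem_open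
      isOpen_interior ⟨t, mem_interior_iff_mem_nhds.2 hnear⟩ |>.imp
        fun q hq => interior_subset hq
    refine absurd hq1 (not_lt.2 ?_)
    have hq0 : 0 < q := by
      have : (0 : ℝ) < q := hq2
      exact_mod_cast this
    exact le_iSup (fun q : {q : ℚ // 0 < q} => ‖F (q : ℚ)‖ₑ) ⟨q, hq0⟩
  · have : (0 : ℝ) < (q : ℚ) := by exact_mod_cast q.2
    exact le_iSup₂ (f := fun (t : ℝ) (_ : 0 < t) => ‖F t‖ₑ) _ this

theorem aemeasurable_besselHeatMaximal (hlam : ∀ j, -(1 / 2 : ℝ) < lam j)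
    (hr_cont : ∀ j, ContinuousOn (r j) (Ioi 0)) (hr_pos : ∀ j, ∀ t : ℝ, 0 < t → 0 < r j t)
    {p : ℝ≥0∞} (hp : 1 ≤ p) {f : (Fin n → ℝ) → 𝕜} (hf : MemLp f p (besselMeasure lam)) :
    AEMeasurable (besselHeatMaximal lam r f) (besselMeasure lam) := by
  have hae : (fun x => ⨆ q : {q : ℚ // 0 < q}, ‖besselHeat lam (fun j => r j (q : ℚ)) f x‖ₑ)
      =ᵐ[besselMeasure lam] besselHeatMaximal lam r f := by
    filter_upwards [ae_mem_orthant lam] with x hx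
    refine (iSup_enorm_eq_iSup_rat (F := fun t => besselHeat lam (fun j => r j t) f x) ?_).symm
    intro t ht
    have hg : ContinuousWithinAt (fun t j => r j t) (Ioi 0) t :=
      continuousWithinAt_pi.2 fun j => hr_cont j t ht
    have hb : ContinuousAt (fun s' => besselHeat lam s' f x) (fun j => r j t) :=
      continuousAt_besselHeat hlam (fun j => hr_pos j t ht) (mem_orthant.1 hx) hp hf
    exact ContinuousAt.comp_continuousWithinAt (g := fun s' => besselHeat lam s' f x)
      (f := fun t j => r j t) hb hg
  refine AEMeasurable.congr (AEMeasurable.iSup fun q => ?_) hae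
  have hq : (0 : ℝ) < (q : ℚ) := by exact_mod_cast q.2
  exact (aestronglyMeasurable_besselHeat hlam (fun j => hr_pos j _ hq) hf.1).enorm

/-- The rectangles with half sides `2 ^ m * √(r j t)`, indexed by their centre in the orthant and
by `t > 0`. For fixed `m` they increase with `t`, as every `r j` does. -/
def curveRect (r : Fin n → ℝ → ℝ) (m : ℕ) (i : {c : Fin n → ℝ // c ∈ orthant n} × Ioi (0 : ℝ)) :
    Set (Fin n → ℝ) :=
  rect i.1 fun j => 2 ^ m * √(r j i.2)

theorem isOpen_curveRect (m : ℕ) (i : {c : Fin n → ℝ // c ∈ orthant n} × Ioi (0 : ℝ)) :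
    IsOpen (curveRect r m i) := isOpen_rect

/-- The maximal operator is dominated by the weighted sum of the maximal functions over the
families `curveRect r m`. -/
theorem exists_besselHeatMaximal_le (hlam : ∀ j, -(1 / 2 : ℝ) < lam j)
    (hr_pos : ∀ j, ∀ t : ℝ, 0 < t → 0 < r j t) :
    ∃ A : ℝ≥0, ∀ f : (Fin n → ℝ) → 𝕜, AEStronglyMeasurable f (besselMeasure lam) →
      ∀ᵐ x ∂besselMeasure lam, besselHeatMaximal lam r f x ≤
        A * weightedMaximal (besselMeasure lam) (curveRect r) (fun y => ‖f y‖ₑ) x := by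
  obtain ⟨A, h⟩ := exists_enorm_kernel_smul_le (𝕜 := 𝕜) hlam
  refine ⟨A, fun f hf => ?_⟩
  filter_upwards [ae_mem_orthant lam] with x hx
  refine iSup₂_le fun t ht => ?_
  have hs : ∀ j, 0 < r j t := fun j => hr_pos j t ht
  calc ‖besselHeat lam (fun j => r j t) f x‖ₑ
      ≤ ∫⁻ y, ‖besselHeatKernelPi lam (fun j => r j t) x y • f y‖ₑ ∂besselMeasure lam :=
        enorm_integral_le_lintegral_enorm _
    _ ≤ ∫⁻ y, A * (besselMajorant lam (fun j => r j t) (fun j => r j t) x y * ‖f y‖ₑ)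
          ∂besselMeasure lam :=
        lintegral_mono_ae (h f _ _ _ x hs le_rfl le_rfl (mem_orthant.1 hx))
    _ ≤ _ := by
        rw [lintegral_const_mul' _ _ ENNReal.coe_ne_top, lintegral_besselMajorant_mul hf.enorm]
        refine mul_le_mul_right (ENNReal.tsum_le_tsum fun m => mul_le_mul_right ?_ _) _
        refine le_setMaximal (R := curveRect r m) (i := (⟨x, hx⟩, ⟨t, ht⟩)) ?_
        exact self_mem_rect fun j => by
          have := Real.sqrt_pos.2 (hs j)
          positivity

/-- As all half sides increase with `t`, a rectangle that meets one with a larger `t` lies in the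
threefold enlargement of the latter. The doubling constant does not see the factor `2 ^ m`, so
that the bound is uniform in `m`. -/
theorem exists_mul_measure_lt_setMaximal_curveRect_le (hlam : ∀ j, -(1 / 2 : ℝ) < lam j)
    (hr_mono : ∀ j, MonotoneOn (r j) (Ioi 0)) (hr_pos : ∀ j, ∀ t : ℝ, 0 < t → 0 < r j t) :
    ∃ D : ℝ≥0, ∀ (m : ℕ) (g : (Fin n → ℝ) → ℝ≥0∞) (γ : ℝ≥0∞),
      γ * besselMeasure lam {x | γ < setMaximal (besselMeasure lam) (curveRect r m) g x} ≤
        D * ∫⁻ y, g y ∂besselMeasure lam := by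
  obtain ⟨D, M, -, hdoub⟩ := exists_besselMeasure_rect_mul_le hlam
  refine ⟨(D * 3 ^ M).toNNReal, fun m g γ => ?_⟩
  have hρ : ∀ (i : {c : Fin n → ℝ // c ∈ orthant n} × Ioi (0 : ℝ)) (j : Fin n),
      0 < 2 ^ m * √(r j i.2) := fun i j => by
    have := Real.sqrt_pos.2 (hr_pos j i.2 i.2.2)
    positivity
  have hne : ∀ i, (curveRect r m i).Nonempty := fun i => ⟨i.1.1, self_mem_rect (hρ i)⟩
  have hengulf : ∀ i k, (curveRect r m i ∩ curveRect r m k).Nonempty → (i.2 : ℝ) ≤ k.2 →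
      curveRect r m i ⊆ rect k.1 fun j => 3 * (2 ^ m * √(r j k.2)) := fun i k hik hδ =>
    rect_subset_of_inter_nonempty hik fun j => by
      have := hr_mono j i.2.2 k.2.2 hδ
      gcongr
  exact mul_measure_lt_setMaximal_le (R := curveRect r m)
    (R' := fun i => rect i.1.1 fun j => 3 * (2 ^ m * √(r j i.2.1))) (fun i => i.2.1)
    (isOpen_curveRect m) hne hengulf
    (fun i => hdoub i.1.1 _ 3 (mem_orthant.1 i.1.2) (hρ i) (by norm_num)) g γ

theorem exists_eLpNorm_besselHeatMaximal_le (hlam : ∀ j, -(1 / 2 : ℝ) < lam j)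
    (hr_mono : ∀ j, MonotoneOn (r j) (Ioi 0)) (hr_pos : ∀ j, ∀ t : ℝ, 0 < t → 0 < r j t)
    {p : ℝ≥0∞} (hp : 1 < p) :
    ∃ C : ℝ≥0, ∀ f : (Fin n → ℝ) → 𝕜, AEStronglyMeasurable f (besselMeasure lam) →
      eLpNorm (besselHeatMaximal lam r f) p (besselMeasure lam) ≤
        C * eLpNorm f p (besselMeasure lam) := by
  obtain ⟨A, hA⟩ := exists_besselHeatMaximal_le (𝕜 := 𝕜) hlam hr_pos
  obtain ⟨D, hD⟩ := exists_mul_measure_lt_setMaximal_curveRect_le hlam hr_mono hr_pos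
  set μ := besselMeasure lam
  rcases eq_or_ne p ∞ with rfl | hpt
  · refine ⟨A * 2, fun f hf => ?_⟩
    rw [eLpNorm_exponent_top, eLpNorm_exponent_top]
    refine eLpNormEssSup_le_of_ae_enorm_bound ?_
    filter_upwards [hA f hf] with x hx
    rw [enorm_eq_self]
    refine hx.trans ?_
    rw [ENNReal.coe_mul, mul_assoc]
    gcongr
    exact (weightedMaximal_mono_ae (h := fun _ => eLpNormEssSup f μ)
      (enorm_ae_le_eLpNormEssSup f μ) x).trans (weightedMaximal_const_le _ x)
  · have hp1 : 1 < p.toReal := by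
      rw [← ENNReal.toReal_one]
      exact (ENNReal.toReal_lt_toReal ENNReal.one_ne_top hpt).2 hp
    have hp0 : 0 < p.toReal := by linarith
    have hpz : p ≠ 0 := (zero_lt_one.trans hp).ne'
    set B : ℝ≥0∞ := ENNReal.ofReal p.toReal * (8 * D) *
      (4 ^ (p.toReal - 1) / ENNReal.ofReal (p.toReal - 1)) with hB
    have hBt : B ≠ ∞ := by
      refine ENNReal.mul_ne_top (ENNReal.mul_ne_top ENNReal.ofReal_ne_top
        (ENNReal.mul_ne_top (by simp) ENNReal.coe_ne_top)) ?_
      refine ENNReal.div_ne_top (ENNReal.rpow_ne_top_of_nonneg (by linarith) (by simp)) ?_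
      simpa using hp1
    have hCt : (A : ℝ≥0∞) * B ^ (1 / p.toReal) ≠ ∞ :=
      ENNReal.mul_ne_top ENNReal.coe_ne_top
        (ENNReal.rpow_ne_top_of_nonneg (by positivity) hBt)
    refine ⟨((A : ℝ≥0∞) * B ^ (1 / p.toReal)).toNNReal, fun f hf => ?_⟩
    rw [ENNReal.coe_toNNReal hCt, eLpNorm_eq_lintegral_rpow_enorm_toReal hpz hpt,
      eLpNorm_eq_lintegral_rpow_enorm_toReal hpz hpt]
    have hstrong := lintegral_weightedMaximal_rpow_le (μ := μ) (R := curveRect r)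
      isOpen_curveRect hD hp1 hf.enorm
    calc (∫⁻ x, ‖besselHeatMaximal lam r f x‖ₑ ^ p.toReal ∂μ) ^ (1 / p.toReal)
        ≤ (∫⁻ x, A ^ p.toReal *
            weightedMaximal μ (curveRect r) (fun y => ‖f y‖ₑ) x ^ p.toReal ∂μ) ^
              (1 / p.toReal) := by
          refine ENNReal.rpow_le_rpow (lintegral_mono_ae ?_) (by positivity)
          filter_upwards [hA f hf] with x hx
          rw [enorm_eq_self, ← ENNReal.mul_rpow_of_nonneg _ _ hp0.le]
          gcongr
      _ ≤ (A ^ p.toReal * (B * ∫⁻ x, ‖f x‖ₑ ^ p.toReal ∂μ)) ^ (1 / p.toReal) := by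
          rw [lintegral_const_mul' _ _
            (ENNReal.rpow_ne_top_of_nonneg hp0.le ENNReal.coe_ne_top)]
          gcongr
      _ = _ := by
          rw [ENNReal.mul_rpow_of_nonneg _ _ (by positivity),
            ENNReal.mul_rpow_of_nonneg _ _ (by positivity), ← ENNReal.rpow_mul,
            mul_one_div_cancel hp0.ne', ENNReal.rpow_one, mul_assoc]

theorem exists_mul_measure_lt_besselHeatMaximal_le (hlam : ∀ j, -(1 / 2 : ℝ) < lam j)
    (hr_mono : ∀ j, MonotoneOn (r j) (Ioi 0)) (hr_pos : ∀ j, ∀ t : ℝ, 0 < t → 0 < r j t) :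
    ∃ C : ℝ≥0, ∀ f : (Fin n → ℝ) → 𝕜, AEStronglyMeasurable f (besselMeasure lam) → ∀ γ : ℝ≥0∞,
      γ * besselMeasure lam {x | γ < besselHeatMaximal lam r f x} ≤
        C * eLpNorm f 1 (besselMeasure lam) := by
  obtain ⟨A, hA⟩ := exists_besselHeatMaximal_le (𝕜 := 𝕜) hlam hr_pos
  obtain ⟨D, hD⟩ := exists_mul_measure_lt_setMaximal_curveRect_le hlam hr_mono hr_pos
  set μ := besselMeasure lam
  -- `A + 1` instead of `A`, to divide by a nonzero number
  refine ⟨(A + 1) * (4 * D), fun f hf γ => ?_⟩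
  have hA0 : ((A + 1 : ℝ≥0) : ℝ≥0∞) ≠ 0 := by simp
  have hAt : ((A + 1 : ℝ≥0) : ℝ≥0∞) ≠ ∞ := ENNReal.coe_ne_top
  have hw := mul_measure_lt_weightedMaximal_le (fun m γ' => hD m (fun y => ‖f y‖ₑ) γ')
    (γ / (A + 1 : ℝ≥0))
  calc γ * μ {x | γ < besselHeatMaximal lam r f x}
      ≤ γ * μ {x | γ / (A + 1 : ℝ≥0) <
          weightedMaximal μ (curveRect r) (fun y => ‖f y‖ₑ) x} := by
        refine mul_le_mul_right (measure_mono_ae ?_) _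
        filter_upwards [hA f hf] with x hx
        intro (hlt : γ < besselHeatMaximal lam r f x)
        change γ / (A + 1 : ℝ≥0) < weightedMaximal μ (curveRect r) (fun y => ‖f y‖ₑ) x
        rw [ENNReal.div_lt_iff (Or.inl hA0) (Or.inl hAt), mul_comm]
        refine lt_of_lt_of_le hlt (hx.trans ?_)
        gcongr
        exact le_self_add
    _ = (A + 1 : ℝ≥0) * (γ / (A + 1 : ℝ≥0) * μ {x | γ / (A + 1 : ℝ≥0) <
          weightedMaximal μ (curveRect r) (fun y => ‖f y‖ₑ) x}) := by
        rw [← mul_assoc, ENNReal.mul_div_cancel hA0 hAt]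
    _ ≤ (A + 1 : ℝ≥0) * (4 * (D * ∫⁻ y, ‖f y‖ₑ ∂μ)) := by gcongr
    _ = _ := by
        rw [eLpNorm_one_eq_lintegral_enorm]
        push_cast
        ring

end Maximal

theorem theorem1p1 {𝕜 : Type*} [RCLike 𝕜] (n : ℕ) (lam : Fin n → ℝ)
    (hlam : ∀ j, -(1 / 2 : ℝ) < lam j)
    (r : Fin n → ℝ → ℝ)
    (hr_cont : ∀ j, ContinuousOn (r j) (Ici 0))
    (hr_mono : ∀ j, MonotoneOn (r j) (Ici 0))
    (hr_zero : ∀ j, r j 0 = 0)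
    (hr_pos : ∀ j, ∀ t : ℝ, 0 < t → 0 < r j t)
    (hr_top : ∀ j, Tendsto (r j) atTop atTop) :
    -- the operators are given by absolutely convergent integrals on every `L^p`, `1 ≤ p ≤ ∞`,
    -- and the maximal function is measurable
    (∀ p : ℝ≥0∞, 1 ≤ p → ∀ f : (Fin n → ℝ) → 𝕜, MemLp f p (besselMeasure lam) →
      (∀ t : ℝ, 0 < t → ∀ x : Fin n → ℝ, (∀ j, 0 < x j) →
        Integrable (fun y => besselHeatKernelPi lam (fun j => r j t) x y • f y)
          (besselMeasure lam)) ∧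
      AEMeasurable (besselHeatMaximal lam r f) (besselMeasure lam)) ∧
    -- strong type `(p, p)` for `1 < p ≤ ∞`
    (∀ p : ℝ≥0∞, 1 < p → ∃ C : ℝ≥0, ∀ f : (Fin n → ℝ) → 𝕜, MemLp f p (besselMeasure lam) →
      eLpNorm (besselHeatMaximal lam r f) p (besselMeasure lam)
        ≤ C * eLpNorm f p (besselMeasure lam)) ∧
    -- weak type `(1, 1)`
    (∃ C : ℝ≥0, ∀ f : (Fin n → ℝ) → 𝕜, MemLp f 1 (besselMeasure lam) →
      ∀ γ : ℝ≥0, 0 < γ →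
        (γ : ℝ≥0∞) * besselMeasure lam {x | (γ : ℝ≥0∞) < besselHeatMaximal lam r f x}
          ≤ C * eLpNorm f 1 (besselMeasure lam)) := by
  have hcont : ∀ j, ContinuousOn (r j) (Ioi 0) := fun j => (hr_cont j).mono Ioi_subset_Ici_self
  have hmono : ∀ j, MonotoneOn (r j) (Ioi 0) := fun j => (hr_mono j).mono Ioi_subset_Ici_self
  refine ⟨fun p hp f hf => ⟨fun t ht x hx => ?_, ?_⟩, fun p hp => ?_, ?_⟩
  · exact integrable_besselHeatKernelPi_smul hlam (fun j => hr_pos j t ht) hx hp hf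
  · exact aemeasurable_besselHeatMaximal hlam hcont hr_pos hp hf
  · obtain ⟨C, hC⟩ := exists_eLpNorm_besselHeatMaximal_le (𝕜 := 𝕜) hlam hmono hr_pos hp
    exact ⟨C, fun f hf => hC f hf.1⟩
  · obtain ⟨C, hC⟩ := exists_mul_measure_lt_besselHeatMaximal_le (𝕜 := 𝕜) hlam hmono hr_pos
    exact ⟨C, fun f hf γ _ => hC f hf.1 γ⟩
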